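/- Let $K_{4.22}$, $K_{4.47}$, $K_{4.91}$ be the virtual knots numbered 4.22, 4.47 and 4.91 in Green's table, given by the signed Gauss codes $$4.22:\ O1^-O2^-U1^-O3^+O4^+U2^-U3^+U4^+,\qquad 4.47:\ O1^-U2^+O3^-O4^+U3^-O2^+U1^-U4^+,$$ $$4.91:\ O1^-O2^-O3^-O4^-U1^-U2^-U3^-U4^-$$ and represented by explicit virtual knot diagrams with these Gauss codes, with five, three and three virtual crossings respectively. Two virtual knot diagrams are equivalent if they are related by a finite sequence of classical and virtual Reidemeister moves. The virtual crossing number $v(K)$ is the minimum number of virtual crossings of a diagram equivalent to a diagram of $K$, and the minimal genus of $K$ is the least genus of a closed oriented surface $F$ such that $K$ is represented by a knot in $F\times[0,1]$, that is, by a knot diagram on $F$ without virtual crossings. Let $$\langle K\rangle_A=\sum_S A^{\alpha(S)-\beta(S)}\,(-A^2-A^{-2})^{|S|-1}\,\langle S\rangle\ \in\ \mathbb Z[A,A^{-1},K_1,K_2,\dots]$$ be the (unnormalized) arrow polynomial of the given diagram. Here $S$ runs over the choices, at each classical crossing, of the smoothing that respects the orientation or of the one that does not. The former has weight $A$ at a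 positive and $A^{-1}$ at a negative crossing, the latter the inverse weight, and $A^{\alpha(S)-\beta(S)}$ is the product of the weights. The latter also puts a nodal arrow (cusp) on each of its two branches. $|S|$ is the number of loops of $S$, and $\langle S\rangle$ is the product over these loops of $K_n$, where $2n$ is the number of nodal arrows left on the loop when consecutive cusps on the same side have been cancelled ($K_0=1$). The $k$-degree of a monomial $A^mK_{i_1}^{p_1}\cdots K_{i_n}^{p_n}$ is $i_1p_1+\dots+i_np_n$. Then: 1. $v(K_{4.22})=3$, and $\langle K_{4.22}\rangle_A$ has maximum $k$-degree $3$; it equals $$-A^{6}K_1+A^{2}K_1+K_2+2-A^{2}K_1K_2-A^{-2}K_1K_2-K_1^{2}-A^{-4}K_1^{2}+A^{2}K_1^{3}+2A^{-2}K_1^{3}+A^{-6}K_1^{3}-A^{-2}K_1-A^{-6}K_1.$$ 2. $v(K_{4.47})=3$, and $\langle K_{4.47}\rangle_A$ has maximum $k$-degree $3$; it equals $$A^{2}K_3+1-A^{-2}K_1K_2-A^{2}K_1K_2+A^{-2}K_1.$$ 3. $v(K_{4.91})=3$, the minimal genus of $K_{4.91}$ is $1$, and $\langle K_{4.91}\rangle_A$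 has maximum $k$-degree $3$; it equals $$-A^{10}K_1^{3}-A^{6}K_1^{3}+A^{2}K_1^{3}+2A^{6}K_1+A^{-2}K_1^{3}-2A^{2}K_1+A^{-4}.$$ -/

import Mathlib

/-!
Virtual knot diagrams, their Reidemeister moves, the virtual crossing number, the minimal genus,
and the arrow polynomial.

A diagram is an oriented closed curve on the sphere (the plane with a point at infinity) with
transverse double points, each of them classical or virtual. It is recorded by the cyclic list of
the passages of the curve through its crossings. Each passage carries the name of its crossing, the
way in which the other strand crosses (from right to left or from left to right), and
whether the passage is over, under or virtual. The list determines a cellular embedding of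
the underlying 4-valent graph in a closed oriented surface. It is a diagram on the sphere exactly
when this surface has genus zero.
-/

namespace VirtualKnot

/-- How the curve passes through a crossing. -/
inductive Pass where
  | over
  | under
  | virt
  deriving DecidableEq

/-- The passage of the other strand through the same crossing. -/
def Pass.opposite : Pass → Pass
  | .over => .under
  | .under => .over
  | .virt => .virt

/-- One passage of the oriented curve through a crossing: the name of the crossing, whether the
other strand crosses from right to left (so that it leaves on the left hand side), and the kind of
the passage. -/
structure Passage where
  crossing : ℕ
  left : Bool
  pass : Pass
  deriving DecidableEq

/-- The other passage through the same crossing. -/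
def Passage.partner (l : Passage) : Passage := ⟨l.crossing, !l.left, l.pass.opposite⟩

/-- The passages of a closed oriented curve in the order of traversal, read cyclically. -/
abbrev Code := List Passage

/-- Every crossing that occurs is passed exactly twice, by two passages that fit together. -/
def Valid (w : Code) : Prop :=
  (w.map fun l => (l.crossing, l.left)).Nodup ∧ ∀ l ∈ w, l.partner ∈ w

instance (w : Code) : Decidable (Valid w) := by unfold Valid; infer_instance

/-- The passage after `l` in the cyclic order. -/
def next (w : Code) (l : Passage) : Passage := w.getD ((w.idxOf l + 1) % w.length) l

/-- The passage before `l` in the cyclic order. -/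
def prev (w : Code) (l : Passage) : Passage := w.getD ((w.idxOf l + (w.length - 1)) % w.length) l

/-! ### Faces and genus -/

/-- A directed edge: `(l, true)` is the edge that ends at the passage `l`, travelled along the
orientation; `(l, false)` is the edge that starts at the passage `l`, travelled against the
orientation. In both cases one is about to arrive at `l`. -/
abbrev Dart := Passage × Bool

/-- All directed edges of a code. -/
def darts (w : Code) : Finset Dart := w.toFinset ×ˢ Finset.univ

/-- The orbit of a directed edge under a map that permutes the directed edges of `w`. -/
def orbit (w : Code) (f : Dart → Dart) (d : Dart) : Finset Dart :=
  (Finset.range (2 * w.length)).image fun k => f^[k] d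

/-- At the next crossing turn left into the other strand. The orbits are the boundaries of the
faces, each travelled with the face on the left. -/
def turnLeft (w : Code) (d : Dart) : Dart :=
  if d.1.left = d.2 then (next w d.1.partner, true) else (prev w d.1.partner, false)

/-- The number of faces. The circle without crossings lies on the sphere and has two. -/
def numFaces (w : Code) : ℕ :=
  if w = [] then 2 else ((darts w).image (orbit w (turnLeft w))).card

/-- The closed oriented surface in which `w` is cellularly embedded has genus `g`, that is,
`V - E + F = 2 - 2 g` with `V = w.length / 2` and `E = w.length`. -/
def HasGenus (w : Code) (g : ℕ) : Prop := 2 * numFaces w + 4 * g = w.length + 4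

instance (w : Code) (g : ℕ) : Decidable (HasGenus w g) := by unfold HasGenus; infer_instance

/-- A virtual knot diagram (on the sphere). -/
structure Diagram where
  code : Code
  valid : Valid code
  planar : HasGenus code 0

/-! ### Reidemeister moves -/

/-- Rename the crossings. -/
def Passage.rename (f : ℕ → ℕ) (l : Passage) : Passage := ⟨f l.crossing, l.left, l.pass⟩

/-- The triangles that may be moved. Let three strands `1, 2, 3` cross pairwise; `p` and `q` are
the passages of strand `1` across strands `2` and `3`, and `r` is the passage of strand `2` across
strand `3`. Either at least two of the crossings are virtual, or all three are classical and the
strands lie one above another. The triangles with exactly one virtual crossing are forbidden. -/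
def TriangleAllowed (p q r : Pass) : Prop :=
  (p = .virt ∧ q = .virt) ∨ (p = .virt ∧ r = .virt) ∨ (q = .virt ∧ r = .virt) ∨
    (p ≠ .virt ∧ q ≠ .virt ∧ r ≠ .virt ∧ (p = r → q = p))

/-- The two passages `a`, `b` in this order if `c` holds, otherwise in the opposite order. -/
def ordered (c : Bool) (a b : Passage) : Code := if c then [a, b] else [b, a]

/-- The classical and virtual Reidemeister moves. They are used only between diagrams on the sphere;
there the side data make the two passages of `r1` bound a monogon, those of `r2` and `r2'` a bigon,
and those of `r3` a triangle. -/
inductive Move : Code → Code → Prop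
  /-- Choice of the base point. -/
  | rotate (u v : Code) : Move (u ++ v) (v ++ u)
  /-- Choice of the names of the crossings. -/
  | rename (f : ℕ → ℕ) (hf : f.Injective) (w : Code) : Move w (w.map (Passage.rename f))
  /-- First move, classical or virtual: removal of a kink. -/
  | r1 (a : Passage) (w : Code) : Move (a :: a.partner :: w) w
  /-- Second move, both strands in the same direction: one strand is above the other at both
  crossings, or both crossings are virtual. -/
  | r2 (a b : Passage) (u v : Code) (hp : a.pass = b.pass) (hs : a.left ≠ b.left) :
      Move ([a, b] ++ u ++ [a.partner, b.partner] ++ v) (u ++ v)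
  /-- Second move, strands in opposite directions. -/
  | r2' (a b : Passage) (u v : Code) (hp : a.pass = b.pass) (hs : a.left ≠ b.left) :
      Move ([a, b] ++ u ++ [b.partner, a.partner] ++ v) (u ++ v)
  /-- Third move, classical, virtual or mixed. The crossings of the strands `1, 2`, `1, 3` and
  `2, 3` are those of `x`, `y` and `z`; strand `1` meets strand `2` first. For three lines in the
  plane the order of the crossings on the strands `2` and `3` is determined by the sides. The
  move reverses the order on each strand. -/
  | r3 (x y z : Passage) (u v w : Code) (h : TriangleAllowed x.pass y.pass z.pass) :
      Move
        ([x, y] ++ u ++ ordered (y.left == z.left) x.partner z ++ v ++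
          ordered (x.left == z.left) y.partner z.partner ++ w)
        ([y, x] ++ u ++ ordered (y.left == z.left) z x.partner ++ v ++
          ordered (x.left == z.left) z.partner y.partner ++ w)

/-- Two diagrams represent the same virtual knot if a finite sequence of classical and virtual
Reidemeister moves (and their inverses) leads from one to the other. -/
def Equivalent : Diagram → Diagram → Prop :=
  Relation.EqvGen fun D E => Move D.code E.code

/-! ### Virtual crossing number and minimal genus -/

/-- The number of virtual crossings of a diagram (one of the two passages of each is counted). -/
def Diagram.numVirtual (D : Diagram) : ℕ :=
  D.code.countP fun l => decide (l.pass = .virt) && l.left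

/-- The least number of virtual crossings in a diagram of the same virtual knot. -/
noncomputable def virtualCrossingNumber (D : Diagram) : ℕ :=
  sInf {n | ∃ E : Diagram, Equivalent D E ∧ E.numVirtual = n}

/-- The Gauss code: the passages through the classical crossings. -/
def gaussCode (w : Code) : Code := w.filter fun l => decide (l.pass ≠ .virt)

/-- The least genus of a closed oriented surface `F` such that the virtual knot is represented by
a knot in `F × [0, 1]`. Such a knot is given by a diagram on `F` without virtual crossings, and
represents the virtual knots of the diagrams on the sphere with the same Gauss code. The genus of
`F` is least possible for a given Gauss code when the diagram is cellularly embedded. -/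
noncomputable def minimalGenus (D : Diagram) : ℕ :=
  sInf {g | ∃ E : Diagram, Equivalent D E ∧ HasGenus (gaussCode E.code) g}

/-! ### The arrow polynomial -/

/-- The sign of a classical crossing, read off from either of its passages. -/
def Passage.sign (l : Passage) : ℤ := if l.left = decide (l.pass = .over) then 1 else -1

/-- The names of the crossings. -/
def crossings (w : Code) : Finset ℕ := (w.map Passage.crossing).toFinset

/-- Travel along the curves of a state. At the crossings in `S` the smoothing is the one that does
not respect the orientation: an incoming edge continues backwards along the other incoming edge,
and an outgoing edge, reached backwards, continues along the other outgoing edge. At all other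
crossings the smoothing respects the orientation. -/
def travel (w : Code) (S : Finset ℕ) (d : Dart) : Dart :=
  if d.1.crossing ∈ S ↔ d.2 = false then (next w d.1.partner, true)
  else (prev w d.1.partner, false)

/-- The same edge in the opposite direction. -/
def reverse (w : Code) (d : Dart) : Dart :=
  if d.2 then (prev w d.1, false) else (next w d.1, true)

/-- The loops of a state. A loop is the set of its two directed versions. -/
def loops (w : Code) (S : Finset ℕ) : Finset (Finset (Finset Dart)) :=
  (darts w).image fun d => {orbit w (travel w S) d, orbit w (travel w S) (reverse w d)}

/-- The alternating number of nodal arrows on a directed loop. A nodal arrow is a cusp, at a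
smoothing in `S`, that points to the left or to the right of the directed loop. It counts `1` if it
points to the left and `-1` if it points to the right, with an additional factor `-1` at
every second cusp, namely where the loop is reached against the orientation of the knot. So
consecutive cusps that point to the same side cancel. -/
def arrowSum (S : Finset ℕ) (O : Finset Dart) : ℤ :=
  ∑ d ∈ O, if d.1.crossing ∈ S then (if d.1.left = d.2 then 1 else -1) else 0

/-- Half the number of nodal arrows that remain on a loop after all cancellations. (The two
directed versions of the loop have opposite alternating numbers.) -/
def loopIndex (S : Finset ℕ) (c : Finset (Finset Dart)) : ℕ :=
  (c.sup fun O => (arrowSum S O).natAbs) / 2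

/-- The exponent of `A` in the weight of a state: a positive crossing contributes `1` for
the smoothing that respects the orientation and `-1` for the other, a negative crossing the
opposite. -/
def stateExponent (w : Code) (S : Finset ℕ) : ℤ :=
  ((w.filter fun l => decide (l.pass = .over)).map fun l =>
    if l.crossing ∈ S then -l.sign else l.sign).sum

/-- Polynomials in `K₁, K₂, …` over `ℤ[A, A⁻¹]`. -/
abbrev ArrowRing := MvPolynomial ℕ (LaurentPolynomial ℤ)

/-- The value of a loop with `2 n` nodal arrows, where `K₀ = 1`. -/
noncomputable def K (n : ℕ) : ArrowRing := if n = 0 then 1 else MvPolynomial.X n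

/-- The power `A ^ m`. -/
noncomputable def A (m : ℤ) : ArrowRing := MvPolynomial.C (LaurentPolynomial.T m)

/-- The (unnormalized) arrow polynomial of a Gauss code, as a sum over states. The code without
crossings has one state with value `1`. -/
noncomputable def arrowOfGaussCode (w : Code) : ArrowRing :=
  ∑ S ∈ (crossings w).powerset,
    A (stateExponent w S) * (-A 2 - A (-2)) ^ ((loops w S).card - 1) *
      ∏ c ∈ loops w S, K (loopIndex S c)

/-- The arrow polynomial of a diagram. Virtual crossings are not smoothed. -/
noncomputable def arrowPolynomial (D : Diagram) : ArrowRing := arrowOfGaussCode (gaussCode D.code)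

/-- The maximum of `i₁ p₁ + … + iₙ pₙ` over the summands `A ^ m * K_{i₁} ^ p₁ ⋯ K_{iₙ} ^ pₙ`. -/
noncomputable def maxKDegree (p : ArrowRing) : ℕ := MvPolynomial.weightedTotalDegree id p

/-! ### The knots -/

/-- A diagram with five virtual crossings of the knot 4.22, whose Gauss code is
`O1- O2- U1- O3+ O4+ U2- U3+ U4+`. -/
def knot422 : Diagram where
  code := [⟨1, false, .over⟩, ⟨5, true, .virt⟩, ⟨2, false, .over⟩, ⟨1, true, .under⟩,
    ⟨3, true, .over⟩, ⟨6, false, .virt⟩, ⟨7, false, .virt⟩, ⟨4, true, .over⟩, ⟨5, false, .virt⟩,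
    ⟨2, true, .under⟩, ⟨8, true, .virt⟩, ⟨3, false, .under⟩, ⟨9, false, .virt⟩, ⟨7, true, .virt⟩,
    ⟨4, false, .under⟩, ⟨9, true, .virt⟩, ⟨6, true, .virt⟩, ⟨8, false, .virt⟩]
  valid := by decide +kernel
  planar := by decide +kernel

/-- A diagram of the knot 4.47, whose Gauss code is `O1- U2+ O3- O4+ U3- O2+ U1- U4+`. -/
def knot447 : Diagram where
  code := [⟨1, false, .over⟩, ⟨5, true, .virt⟩, ⟨2, false, .under⟩, ⟨6, true, .virt⟩,
    ⟨3, false, .over⟩, ⟨4, true, .over⟩, ⟨7, false, .virt⟩, ⟨3, true, .under⟩, ⟨5, false, .virt⟩,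
    ⟨2, true, .over⟩, ⟨6, false, .virt⟩, ⟨1, true, .under⟩, ⟨4, false, .under⟩, ⟨7, true, .virt⟩]
  valid := by decide +kernel
  planar := by decide +kernel

/-- A diagram of the knot 4.91, whose Gauss code is `O1- O2- O3- O4- U1- U2- U3- U4-`. -/
def knot491 : Diagram where
  code := [⟨1, false, .over⟩, ⟨5, true, .virt⟩, ⟨2, false, .over⟩, ⟨6, true, .virt⟩,
    ⟨3, false, .over⟩, ⟨7, true, .virt⟩, ⟨4, false, .over⟩, ⟨1, true, .under⟩, ⟨5, false, .virt⟩,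
    ⟨2, true, .under⟩, ⟨6, false, .virt⟩, ⟨3, true, .under⟩, ⟨7, false, .virt⟩, ⟨4, true, .under⟩]
  valid := by decide +kernel
  planar := by decide +kernel

end VirtualKnot

namespace VirtualKnot

/-! ### Iterated sums over the states of crossings -/

section IterSum

variable {T R : Type*} [Fintype T] [CommRing R]

/-- The sum of `F` over all assignments of states to the crossings in the list; all other crossings
are in the state `t`. -/
def iterSum (t : T) : List ℕ → ((ℕ → T) → R) → R
  | [], F => F fun _ => t
  | k :: ks, F => iterSum t ks fun f => ∑ v, F (Function.update f k v)

theorem iterSum_perm (t : T) {ks ks' : List ℕ} (h : ks.Perm ks') (F : (ℕ → T) → R) :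
    iterSum t ks F = iterSum t ks' F := by
  induction h generalizing F with
  | nil => rfl
  | cons k _ ih => exact ih _
  | swap k l ks =>
    simp only [iterSum]
    congr 1
    funext f
    rcases eq_or_ne k l with rfl | h
    · rfl
    · rw [Finset.sum_comm]
      refine Finset.sum_congr rfl fun v _ => Finset.sum_congr rfl fun v' _ => ?_
      rw [Function.update_comm h]
  | trans _ _ ih ih' => exact (ih F).trans (ih' F)

theorem iterSum_map (t : T) {σ : ℕ → ℕ} (hσ : σ.Injective) (ks : List ℕ) (F : (ℕ → T) → R) :
    iterSum t (ks.map σ) (fun f => F (f ∘ σ)) = iterSum t ks F := by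
  induction ks generalizing F with
  | nil => rfl
  | cons k ks ih =>
    simp only [List.map_cons, iterSum, Function.update_comp_eq_of_injective _ hσ]
    exact ih fun f => ∑ v, F (Function.update f k v)

end IterSum

theorem iterSum_mul {T R : Type*} [Fintype T] [CommRing R] (t : T) (ks : List ℕ) (r : R)
    (F : (ℕ → T) → R) : iterSum t ks (fun f => r * F f) = r * iterSum t ks F := by
  induction ks generalizing F with
  | nil => rfl
  | cons k ks ih => simp only [iterSum, ← Finset.mul_sum]; exact ih _

/-- An additive subgroup that contains all values contains the iterated sum. -/
theorem iterSum_mem {T R : Type*} [Fintype T] [CommRing R] (N : AddSubgroup R) (t : T)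
    (ks : List ℕ) (F : (ℕ → T) → R) (h : ∀ f, F f ∈ N) :
    iterSum t ks F ∈ N := by
  induction ks generalizing F with
  | nil => exact h _
  | cons k ks ih => exact ih _ fun f => N.sum_mem fun v _ => h _

/-! ### The state sum -/

/-- Laurent polynomials in one variable over `ZMod 11`. -/
def StateRing : Type := LaurentPolynomial (ZMod 11)

noncomputable instance : CommRing StateRing :=
  inferInstanceAs (CommRing (LaurentPolynomial (ZMod 11)))

/-- The constants. -/
noncomputable def scalar : ZMod 11 →+* StateRing := LaurentPolynomial.C

/-- The powers of the variable. -/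
noncomputable def tpow (n : ℤ) : StateRing := LaurentPolynomial.T n

@[simp] theorem tpow_zero : tpow 0 = 1 := LaurentPolynomial.T_zero

theorem tpow_add (m n : ℤ) : tpow (m + n) = tpow m * tpow n := LaurentPolynomial.T_add m n

/-- Colours of edges. The second component is the charge; traversing an edge backwards changes the
charge. -/
abbrev Colour := Bool × Bool

/-- The colour of the reversed edge. -/
def bar (c : Colour) : Colour := (c.1, !c.2)

/-- The charge of a colour. -/
def charge (c : Colour) : ℤ := if c.2 then 1 else -1

@[simp] theorem bar_bar (c : Colour) : bar (bar c) = c := by simp [bar]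

theorem charge_bar (c : Colour) : charge (bar c) = -charge c := by
  rcases c with ⟨a, _ | _⟩ <;> rfl

theorem bar_inj {c d : Colour} : bar c = bar d ↔ c = d :=
  ⟨fun h => by rw [← bar_bar c, h, bar_bar], fun h => by rw [h]⟩

theorem eq_bar_iff (c d : Colour) : c = bar d ↔ bar c = d :=
  ⟨fun h => by rw [h, bar_bar], fun h => by rw [← h, bar_bar]⟩

/-- A solution of `a ^ 2 + a⁻² = -4` modulo 11 for the sign `1`, and its inverse for the
sign `-1`. -/
def aw (s : Bool) : ZMod 11 := if s then 5 else 9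

/-- The weight of a crossing of sign `s` (`true` is positive) between a strand with the colours `p`
(incoming, outgoing) and a strand with the colours `q`. -/
def bracketWeight (s : Bool) (p q : Colour × Colour) : ZMod 11 :=
  aw s * (if p.1 = q.2 ∧ q.1 = p.2 then 1 else 0) +
    aw (!s) * (if q.1 = bar p.1 ∧ q.2 = bar p.2 then 1 else 0)

/-- The colours of a strand that is traversed backwards. -/
def barPair (p : Colour × Colour) : Colour × Colour := (bar p.2, bar p.1)

theorem bracketWeight_comm (s : Bool) (p q : Colour × Colour) :
    bracketWeight s p q = bracketWeight s q p := by
  unfold bracketWeight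
  congr 2
  · simp only [and_comm]
  · simp only [eq_bar_iff, eq_comm (a := bar p.1), eq_comm (a := bar p.2)]

theorem bracketWeight_barPair (s : Bool) (p q : Colour × Colour) :
    bracketWeight s p (barPair q) = bracketWeight (!s) p q := by
  simp only [bracketWeight, barPair, Bool.not_not]
  rw [add_comm]
  congr 3
  · simp only [bar_inj, eq_comm (a := q.2)]
  · simp only [eq_bar_iff, eq_comm (a := bar p.1)]

theorem charge_conservation {s : Bool} {p q : Colour × Colour} (h : bracketWeight s p q ≠ 0) :
    charge p.1 + charge q.1 = charge p.2 + charge q.2 := by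
  by_contra hc
  apply h
  unfold bracketWeight
  rw [if_neg, if_neg]
  · simp
  · rintro ⟨h1, h2⟩
    rw [h1, h2, charge_bar, charge_bar] at hc
    omega
  · rintro ⟨h1, h2⟩
    rw [h1, h2] at hc
    omega

/-- The colours (incoming, outgoing) at a crossing of the strand whose side is `true` and of the
strand whose side is `false`. -/
abbrev CrossingState := Bool → Colour × Colour

/-- The weight of a crossing. -/
noncomputable def crossingWeight (s : Bool) (v : CrossingState) : StateRing :=
  scalar (bracketWeight s (v true) (v false)) * tpow (charge (v true).1 - charge (v false).2)

/-- Whether the crossing is positive. -/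
def Passage.positive (l : Passage) : Bool := l.left == decide (l.pass = .over)

theorem Passage.positive_partner (l : Passage) (h : l.pass ≠ .virt) :
    l.partner.positive = l.positive := by
  rcases l with ⟨c, _ | _, _ | _ | _⟩ <;> simp_all [Passage.positive, Passage.partner,
      Pass.opposite]

/-- The weight of a crossing, associated with one of its two passages. -/
noncomputable def passageWeight (f : ℕ → CrossingState) (l : Passage) : StateRing :=
  if l.left then crossingWeight l.positive (f l.crossing) else 1

/-- The elementary matrix of a passage. -/
noncomputable def passageMatrix (f : ℕ → CrossingState) (l : Passage) :
    Matrix Colour Colour StateRing :=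
  Matrix.single (f l.crossing l.left).1 (f l.crossing l.left).2 1

/-- The contribution of a colouring. -/
noncomputable def colouringWeight (w : Code) (f : ℕ → CrossingState) : StateRing :=
  (w.map (passageWeight f)).prod * (w.map (passageMatrix f)).prod.trace

/-- The names of the crossings, each once for a valid code. -/
def leftNames (w : Code) : List ℕ := (w.filter Passage.left).map Passage.crossing

/-- The state sum of a Gauss code. -/
noncomputable def stateSum (w : Code) : StateRing :=
  iterSum (fun _ => default) (leftNames w) (colouringWeight w)

theorem sum_ite_unique (p : Colour → Colour → Colour → Prop)
    [∀ a b c, Decidable (p a b c)] (q : Prop) [Decidable q] (a b c : Colour)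
    (h : ∀ x y z, p x y z ↔ (x = a ∧ y = b ∧ z = c) ∧ q) :
    (∑ x, ∑ y, ∑ z, if p x y z then (1 : ZMod 11) else 0) = if q then 1 else 0 := by
  simp only [h]
  split_ifs with hq
  · simp [hq, ite_and]
  · simp [hq]

theorem sum_ite_loop (p : Colour → Colour → Colour → Prop)
    [∀ a b c, Decidable (p a b c)] (q : Prop) [Decidable q]
    (h : ∀ x y z, p x y z ↔ (x = z ∧ y = bar z) ∧ q) :
    (∑ x, ∑ y, ∑ z, if p x y z then (1 : ZMod 11) else 0) = 4 * if q then 1 else 0 := by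
  simp only [h]
  split_ifs with hq
  · simp only [hq, and_true, ite_and]
    decide
  · simp [hq]

/-- The Yang–Baxter equation for the bracket weights. -/
theorem yang_baxter (s₁ s₂ s₃ : Bool) (h : s₁ = s₃ → s₂ = s₁) (i₁ i₂ i₃ o₁ o₂ o₃ : Colour) :
    ∑ m₁, ∑ m₂, ∑ m₃, bracketWeight s₁ (i₁, m₁) (i₂, m₂) * bracketWeight s₂ (m₁, o₁) (i₃, m₃) *
        bracketWeight s₃ (m₂, o₂) (m₃, o₃) =
      ∑ m₁, ∑ m₂, ∑ m₃, bracketWeight s₁ (m₁, o₁) (m₂, o₂) *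
        bracketWeight s₂ (i₁, m₁) (m₃, o₃) * bracketWeight s₃ (i₂, m₂) (i₃, m₃) := by
  have expand : ∀ x x' y y' z z' p p' q q' r r' : ZMod 11,
      (x * p + x' * p') * (y * q + y' * q') * (z * r + z' * r') =
        x * y * z * (p * q * r) + x * y * z' * (p * q * r') + x * y' * z * (p * q' * r) +
        x * y' * z' * (p * q' * r') + x' * y * z * (p' * q * r) + x' * y * z' * (p' * q * r') +
        x' * y' * z * (p' * q' * r) + x' * y' * z' * (p' * q' * r') := by
    intros; ring
  simp only [bracketWeight, expand, Finset.sum_add_distrib, ← Finset.mul_sum,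
    ite_zero_mul_ite_zero, mul_one]
  rw [sum_ite_unique _ (i₁ = o₃ ∧ i₂ = o₂ ∧ i₃ = o₁) i₂ i₁ i₂
    (fun x y z => by grind [bar_bar])]
  rw [sum_ite_unique _ (i₂ = bar i₁ ∧ i₃ = o₁ ∧ o₃ = bar o₂) (bar i₁) i₁ (bar i₁)
    (fun x y z => by grind [bar_bar])]
  rw [sum_ite_unique _ (i₁ = o₃ ∧ i₃ = bar i₂ ∧ o₂ = bar o₁) i₂ i₁ (bar o₁)
    (fun x y z => by grind [bar_bar])]
  rw [sum_ite_unique _ (i₁ = o₁ ∧ i₃ = bar i₂ ∧ o₃ = bar o₂) i₂ i₁ (bar i₁)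
    (fun x y z => by grind [bar_bar])]
  rw [sum_ite_unique _ (i₂ = bar i₁ ∧ i₃ = o₁ ∧ o₃ = bar o₂) o₂ (bar o₂) o₂
    (fun x y z => by grind [bar_bar])]
  rw [sum_ite_loop _ (i₂ = bar i₁ ∧ i₃ = o₁ ∧ o₃ = bar o₂)
    (fun x y z => by grind [bar_bar])]
  rw [sum_ite_unique _ (i₂ = bar i₁ ∧ i₃ = o₃ ∧ o₂ = bar o₁) (bar i₃) i₃ (bar o₁)
    (fun x y z => by grind [bar_bar])]
  rw [sum_ite_unique _ (i₂ = bar i₁ ∧ i₃ = o₁ ∧ o₃ = bar o₂) (bar i₃) i₃ (bar i₃)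
    (fun x y z => by grind [bar_bar])]
  rw [sum_ite_unique _ (i₁ = o₃ ∧ i₂ = o₂ ∧ i₃ = o₁) i₂ i₃ i₂
    (fun x y z => by grind [bar_bar])]
  rw [sum_ite_unique _ (i₁ = o₃ ∧ i₃ = bar i₂ ∧ o₂ = bar o₁) (bar o₁) o₁ (bar o₁)
    (fun x y z => by grind [bar_bar])]
  rw [sum_ite_unique _ (i₂ = bar i₁ ∧ i₃ = o₁ ∧ o₃ = bar o₂) o₂ i₃ (bar i₁)
    (fun x y z => by grind [bar_bar])]
  rw [sum_ite_unique _ (i₁ = o₁ ∧ i₃ = bar i₂ ∧ o₃ = bar o₂) o₂ i₁ (bar i₁)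
    (fun x y z => by grind [bar_bar])]
  rw [sum_ite_unique _ (i₁ = o₃ ∧ i₃ = bar i₂ ∧ o₂ = bar o₁) i₂ (bar i₂) i₂
    (fun x y z => by grind [bar_bar])]
  rw [sum_ite_loop _ (i₁ = o₃ ∧ i₃ = bar i₂ ∧ o₂ = bar o₁)
    (fun x y z => by grind [bar_bar])]
  rw [sum_ite_unique _ (i₂ = bar i₁ ∧ i₃ = o₃ ∧ o₂ = bar o₁) (bar i₃) i₃ (bar i₁)
    (fun x y z => by grind [bar_bar])]
  rw [sum_ite_unique _ (i₁ = o₃ ∧ i₃ = bar i₂ ∧ o₂ = bar o₁) (bar i₁) i₁ (bar i₁)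
    (fun x y z => by grind [bar_bar])]
  revert h
  cases s₁ <;> cases s₂ <;> cases s₃ <;>
    simp only [aw, Bool.not_true, Bool.not_false, if_true, if_false, Bool.false_eq_true,
        forall_const, IsEmpty.forall_iff, Bool.true_eq_false] <;>
    ring_nf <;> reduce_mod_char
theorem bracketWeight_kink (s : Bool) (i o : Colour) :
    ∑ m, bracketWeight s (i, m) (m, o) = if i = o then (if s then 7 else 8) else 0 := by
  revert s i o; decide +kernel

/-- The first or the second half, according to `b`, of a strand with the consecutive
colours `i`, `m`, `o`. -/
def leg (b : Bool) (i m o : Colour) : Colour × Colour := if b then (i, m) else (m, o)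

theorem bracketWeight_bigon (s c : Bool) (i₁ i₂ o₁ o₂ : Colour) :
    ∑ m₁, ∑ m₂, bracketWeight s (leg true i₁ m₁ o₁) (leg c i₂ m₂ o₂) *
        bracketWeight (!s) (leg false i₁ m₁ o₁) (leg (!c) i₂ m₂ o₂) =
      if i₁ = o₁ ∧ i₂ = o₂ then 1 else 0 := by
  revert s c i₁ i₂ o₁ o₂; decide +kernel

theorem barPair_leg (b : Bool) (i m o : Colour) :
    barPair (leg b i m o) = leg (!b) (bar o) (bar m) (bar i) := by
  cases b <;> rfl

/-- The change of variables for reversing a strand. -/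
theorem sum_bar {M : Type*} [CommRing M] (F : Colour → M) :
    ∑ m, F (bar m) = ∑ m, F m :=
  Fintype.sum_equiv ⟨bar, bar, bar_bar, bar_bar⟩ _ _ fun _ => rfl

theorem bracketWeight_barPair' (s : Bool) (p q : Colour × Colour) :
    bracketWeight s p q = bracketWeight (!s) p (barPair q) := by
  rw [bracketWeight_barPair, Bool.not_not]

theorem bracketWeight_barPair_left (s : Bool) (p q : Colour × Colour) :
    bracketWeight s p q = bracketWeight (!s) (barPair p) q := by
  rw [bracketWeight_comm, bracketWeight_barPair', bracketWeight_comm]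

/-- The Yang–Baxter equation for strands with arbitrary directions. -/
theorem yang_baxter_ordered (s₁ s₂ s₃ b₂ b₃ : Bool)
    (h : (s₁ == b₂) = (s₃ == (b₂ == b₃)) → (s₂ == b₃) = (s₁ == b₂))
    (i₁ i₂ i₃ o₁ o₂ o₃ : Colour) :
    ∑ m₁, ∑ m₂, ∑ m₃, bracketWeight s₁ (leg true i₁ m₁ o₁) (leg b₂ i₂ m₂ o₂) *
        bracketWeight s₂ (leg false i₁ m₁ o₁) (leg b₃ i₃ m₃ o₃) *
        bracketWeight s₃ (leg (!b₂) i₂ m₂ o₂) (leg (!b₃) i₃ m₃ o₃) =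
      ∑ m₁, ∑ m₂, ∑ m₃, bracketWeight s₁ (leg false i₁ m₁ o₁) (leg (!b₂) i₂ m₂ o₂) *
        bracketWeight s₂ (leg true i₁ m₁ o₁) (leg (!b₃) i₃ m₃ o₃) *
        bracketWeight s₃ (leg b₂ i₂ m₂ o₂) (leg b₃ i₃ m₃ o₃) := by
  cases b₂ <;> cases b₃
  · have key := yang_baxter (!s₁) (!s₂) s₃
      (by revert h; cases s₁ <;> cases s₂ <;> cases s₃ <;> decide)
      i₁ (bar o₂) (bar o₃) o₁ (bar i₂) (bar i₃)
    refine Eq.trans ?_ (key.trans (Eq.symm ?_))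
    all_goals
      refine Finset.sum_congr rfl fun m₁ _ => ?_
      refine Eq.trans (Finset.sum_congr rfl fun m₂ _ => ?_) (sum_bar _)
      refine Eq.trans (Finset.sum_congr rfl fun m₃ _ => ?_) (sum_bar _)
      rw [bracketWeight_barPair' s₁, bracketWeight_barPair' s₂, bracketWeight_barPair' s₃,
          bracketWeight_barPair_left (!s₃), Bool.not_not]
      simp only [barPair_leg]
      rfl
  · have key := yang_baxter (!s₁) s₂ (!s₃)
      (by revert h; cases s₁ <;> cases s₂ <;> cases s₃ <;> decide)
      i₁ (bar o₂) i₃ o₁ (bar i₂) o₃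
    refine Eq.trans ?_ (key.trans (Eq.symm ?_))
    all_goals
      refine Finset.sum_congr rfl fun m₁ _ => ?_
      refine Eq.trans (Finset.sum_congr rfl fun m₂ _ => ?_) (sum_bar _)
      refine Finset.sum_congr rfl fun m₃ _ => ?_
      rw [bracketWeight_barPair' s₁, bracketWeight_barPair_left s₃]
      simp only [barPair_leg]
      rfl
  · have key := yang_baxter s₁ (!s₂) (!s₃)
      (by revert h; cases s₁ <;> cases s₂ <;> cases s₃ <;> decide)
      i₁ i₂ (bar o₃) o₁ o₂ (bar i₃)
    refine Eq.trans ?_ (key.trans (Eq.symm ?_))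
    all_goals
      refine Finset.sum_congr rfl fun m₁ _ => ?_
      refine Finset.sum_congr rfl fun m₂ _ => ?_
      refine Eq.trans (Finset.sum_congr rfl fun m₃ _ => ?_) (sum_bar _)
      rw [bracketWeight_barPair' s₂, bracketWeight_barPair' s₃]
      simp only [barPair_leg]
      rfl
  · exact yang_baxter s₁ s₂ s₃ (by simpa using h) i₁ i₂ i₃ o₁ o₂ o₃

/-! ### Local invariance -/

/-- The weight of a crossing between two strands with the colours `p` and `q`. The side of the first
strand is `b`. -/
noncomputable def sideWeight (s b : Bool) (p q : Colour × Colour) : StateRing :=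
  scalar (bracketWeight s p q) *
    tpow (if b then charge p.1 - charge q.2 else charge q.1 - charge p.2)

theorem crossingWeight_eq_sideWeight (s b : Bool) (v : CrossingState) :
    crossingWeight s v = sideWeight s b (v b) (v (!b)) := by
  cases b
  · simp [crossingWeight, sideWeight, bracketWeight_comm s (v false)]
  · simp [crossingWeight, sideWeight]

theorem sum_crossingState {M : Type*} [CommRing M] (b : Bool)
    (G : Colour × Colour → Colour × Colour → M) :
    ∑ v : CrossingState, G (v b) (v (!b)) = ∑ p, ∑ q, G p q := by
  rw [← Fintype.sum_prod_type']
  refine Fintype.sum_equiv ⟨fun v => (v b, v (!b)), fun x c => if c = b then x.1 else x.2,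
    fun v => ?_, fun x => ?_⟩ _ _ fun _ => rfl
  · funext c
    cases b <;> cases c <;> rfl
  · cases b <;> rfl

theorem scalar_mul_tpow_congr {c : ZMod 11} {m n : ℤ} (h : c ≠ 0 → m = n) :
    scalar c * tpow m = scalar c * tpow n := by
  by_cases hc : c = 0
  · simp [hc]
  · rw [h hc]

theorem sideWeight_kink (s b : Bool) (i o : Colour) :
    ∑ m, sideWeight s b (i, m) (m, o) = scalar (if s then 7 else 8) * if i = o then 1 else 0 := by
  have h : ∀ m, sideWeight s b (i, m) (m, o) =
      scalar (bracketWeight s (i, m) (m, o)) * tpow (if b then charge i - charge o else 0) := by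
    intro m
    refine scalar_mul_tpow_congr fun hm => ?_
    cases b <;> simp
  simp only [h]
  rw [← Finset.sum_mul, ← map_sum, bracketWeight_kink]
  split_ifs with hio hs hb hb <;> simp [*]

theorem sideWeight_bigon (s b c : Bool) (i₁ i₂ o₁ o₂ : Colour) :
    ∑ m₁, ∑ m₂, sideWeight s b (leg true i₁ m₁ o₁) (leg c i₂ m₂ o₂) *
        sideWeight (!s) (!b) (leg false i₁ m₁ o₁) (leg (!c) i₂ m₂ o₂) =
      if i₁ = o₁ ∧ i₂ = o₂ then 1 else 0 := by
  have h : ∀ m₁ m₂, sideWeight s b (leg true i₁ m₁ o₁) (leg c i₂ m₂ o₂) *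
        sideWeight (!s) (!b) (leg false i₁ m₁ o₁) (leg (!c) i₂ m₂ o₂) =
      scalar (bracketWeight s (leg true i₁ m₁ o₁) (leg c i₂ m₂ o₂) *
        bracketWeight (!s) (leg false i₁ m₁ o₁) (leg (!c) i₂ m₂ o₂)) *
      tpow (if b then (charge i₁ - charge o₁ + if c then 0 else charge i₂ - charge o₂) else
        if c then charge i₂ - charge o₂ else 0) := by
    intro m₁ m₂
    rw [sideWeight, sideWeight, mul_mul_mul_comm, ← map_mul, ← tpow_add]
    congr 2
    cases b <;> cases c <;> simp [leg] <;> ring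
  simp only [h]
  simp only [← Finset.sum_mul, ← map_sum]
  rw [bracketWeight_bigon]
  split_ifs <;> simp [*]

/-- The exponent `1` or `-1` for a side. -/
def sideSign (b : Bool) : ℤ := if b then 1 else -1

theorem sideWeight_triangle (s₁ s₂ s₃ x y z : Bool)
    (h : (s₁ == (y == z)) = (s₃ == ((y == z) == (x == z))) →
      (s₂ == (x == z)) = (s₁ == (y == z)))
    (i₁ i₂ i₃ o₁ o₂ o₃ : Colour) :
    ∑ m₁, ∑ m₂, ∑ m₃, sideWeight s₁ x (leg true i₁ m₁ o₁) (leg (y == z) i₂ m₂ o₂) *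
        sideWeight s₂ y (leg false i₁ m₁ o₁) (leg (x == z) i₃ m₃ o₃) *
        sideWeight s₃ z (leg (!(y == z)) i₂ m₂ o₂) (leg (!(x == z)) i₃ m₃ o₃) =
      ∑ m₁, ∑ m₂, ∑ m₃, sideWeight s₁ x (leg false i₁ m₁ o₁) (leg (!(y == z)) i₂ m₂ o₂) *
        sideWeight s₂ y (leg true i₁ m₁ o₁) (leg (!(x == z)) i₃ m₃ o₃) *
        sideWeight s₃ z (leg (y == z) i₂ m₂ o₂) (leg (x == z) i₃ m₃ o₃) := by
  have expand : ∀ p₁ q₁ p₂ q₂ p₃ q₃, sideWeight s₁ x p₁ q₁ * sideWeight s₂ y p₂ q₂ *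
      sideWeight s₃ z p₃ q₃ = scalar (bracketWeight s₁ p₁ q₁ * bracketWeight s₂ p₂ q₂ *
        bracketWeight s₃ p₃ q₃) *
        tpow ((if x then charge p₁.1 - charge q₁.2 else charge q₁.1 - charge p₁.2) +
          (if y then charge p₂.1 - charge q₂.2 else charge q₂.1 - charge p₂.2) +
          (if z then charge p₃.1 - charge q₃.2 else charge q₃.1 - charge p₃.2)) := by
    intros
    simp only [sideWeight, map_mul, tpow_add]
    ring
  obtain ⟨g, hg⟩ : ∃ g : ℤ, g = (sideSign x + sideSign y) * charge o₁ +
      (if y == z then -sideSign x * charge i₂ + sideSign z * charge o₂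
        else (sideSign z - sideSign x) * charge i₂) +
      (if x == z then (-sideSign x - sideSign y) * charge i₃ +
          (sideSign x - sideSign z) * charge o₃
        else (-sideSign x - sideSign y - sideSign z) * charge i₃ + sideSign x * charge o₃) :=
    ⟨_, rfl⟩
  have hl : ∀ m₁ m₂ m₃, sideWeight s₁ x (leg true i₁ m₁ o₁) (leg (y == z) i₂ m₂ o₂) *
        sideWeight s₂ y (leg false i₁ m₁ o₁) (leg (x == z) i₃ m₃ o₃) *
        sideWeight s₃ z (leg (!(y == z)) i₂ m₂ o₂) (leg (!(x == z)) i₃ m₃ o₃) =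
      scalar (bracketWeight s₁ (leg true i₁ m₁ o₁) (leg (y == z) i₂ m₂ o₂) *
        bracketWeight s₂ (leg false i₁ m₁ o₁) (leg (x == z) i₃ m₃ o₃) *
        bracketWeight s₃ (leg (!(y == z)) i₂ m₂ o₂) (leg (!(x == z)) i₃ m₃ o₃)) * tpow g := by
    intro m₁ m₂ m₃
    rw [expand]
    refine scalar_mul_tpow_congr fun hc => ?_
    have h₁ := charge_conservation (left_ne_zero_of_mul (left_ne_zero_of_mul hc))
    have h₂ := charge_conservation (right_ne_zero_of_mul (left_ne_zero_of_mul hc))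
    have h₃ := charge_conservation (right_ne_zero_of_mul hc)
    rw [hg]
    cases x <;> cases y <;> cases z <;> simp [leg, sideSign] at h₁ h₂ h₃ ⊢ <;> omega
  have hr : ∀ m₁ m₂ m₃, sideWeight s₁ x (leg false i₁ m₁ o₁) (leg (!(y == z)) i₂ m₂ o₂) *
        sideWeight s₂ y (leg true i₁ m₁ o₁) (leg (!(x == z)) i₃ m₃ o₃) *
        sideWeight s₃ z (leg (y == z) i₂ m₂ o₂) (leg (x == z) i₃ m₃ o₃) =
      scalar (bracketWeight s₁ (leg false i₁ m₁ o₁) (leg (!(y == z)) i₂ m₂ o₂) *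
        bracketWeight s₂ (leg true i₁ m₁ o₁) (leg (!(x == z)) i₃ m₃ o₃) *
        bracketWeight s₃ (leg (y == z) i₂ m₂ o₂) (leg (x == z) i₃ m₃ o₃)) * tpow g := by
    intro m₁ m₂ m₃
    rw [expand]
    refine scalar_mul_tpow_congr fun hc => ?_
    have h₁ := charge_conservation (left_ne_zero_of_mul (left_ne_zero_of_mul hc))
    have h₂ := charge_conservation (right_ne_zero_of_mul (left_ne_zero_of_mul hc))
    have h₃ := charge_conservation (right_ne_zero_of_mul hc)
    rw [hg]
    cases x <;> cases y <;> cases z <;> simp [leg, sideSign] at h₁ h₂ h₃ ⊢ <;> omega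
  simp only [hl, hr, ← Finset.sum_mul, ← map_sum]
  rw [yang_baxter_ordered s₁ s₂ s₃ _ _ h]

/-! ### Sums over the colours of strands -/

section Strands

variable {R : Type*} [CommRing R]

/-- The elementary matrix of a pair of colours. -/
def pairMatrix (R : Type*) [CommRing R] (p : Colour × Colour) : Matrix Colour Colour R :=
  Matrix.single p.1 p.2 1

/-- The product of two matrices in this order if `b` holds, otherwise in the opposite order. -/
def orderedMul (b : Bool) (X Y : Matrix Colour Colour R) : Matrix Colour Colour R :=
  if b then X * Y else Y * X

theorem sum_orderedMul (b : Bool)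
    (G : Colour × Colour → Colour × Colour → Matrix Colour Colour R → R)
    (hG : ∀ p q, G p q 0 = 0) :
    ∑ p, ∑ q, G p q (orderedMul b (pairMatrix R p) (pairMatrix R q)) =
      ∑ i, ∑ m, ∑ o, G (leg b i m o) (leg (!b) i m o) (Matrix.single i o 1) := by
  have key : ∀ p q p' q' : Colour × Colour, G p' q' (pairMatrix R p * pairMatrix R q) =
      if p.2 = q.1 then G p' q' (Matrix.single p.1 q.2 1) else 0 := by
    intro p q p' q'
    split_ifs with hpq
    · rw [pairMatrix, pairMatrix, hpq, Matrix.single_mul_single_same, mul_one]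
    · rw [pairMatrix, pairMatrix, Matrix.single_mul_single_of_ne _ _ _ _ hpq, hG]
  cases b
  · rw [Finset.sum_comm]
    simp only [orderedMul, Bool.false_eq_true, if_false, key, Fintype.sum_prod_type, leg,
      Bool.not_false, if_true]
    simp [Finset.sum_ite_irrel]
  · simp only [orderedMul, if_true, key, Fintype.sum_prod_type, leg, Bool.not_true,
      Bool.false_eq_true, if_false]
    simp [Finset.sum_ite_irrel]

theorem sum_leg_two {S : Type*} [CommRing S] (F₁ F₂ : Colour × Colour → Colour × Colour → S)
    (x y c₁ c₂ : Bool) (L : Matrix Colour Colour S → Matrix Colour Colour S → S)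
    (h₁ : ∀ Y, L 0 Y = 0) (h₂ : ∀ X, L X 0 = 0) :
    ∑ v₁ : CrossingState, ∑ v₂ : CrossingState, F₁ (v₁ x) (v₁ !x) * F₂ (v₂ y) (v₂ !y) *
        L (orderedMul c₁ (pairMatrix S (v₁ x)) (pairMatrix S (v₂ y)))
          (orderedMul c₂ (pairMatrix S (v₁ !x)) (pairMatrix S (v₂ !y))) =
      ∑ i₁, ∑ o₁, ∑ i₂, ∑ o₂, (∑ m₁, ∑ m₂, F₁ (leg c₁ i₁ m₁ o₁) (leg c₂ i₂ m₂ o₂) *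
        F₂ (leg (!c₁) i₁ m₁ o₁) (leg (!c₂) i₂ m₂ o₂)) *
        L (Matrix.single i₁ o₁ 1) (Matrix.single i₂ o₂ 1) := by
  rw [sum_crossingState x fun p₁ p₂ => ∑ v₂ : CrossingState, F₁ p₁ p₂ * F₂ (v₂ y) (v₂ !y) *
        L (orderedMul c₁ (pairMatrix S p₁) (pairMatrix S (v₂ y)))
          (orderedMul c₂ (pairMatrix S p₂) (pairMatrix S (v₂ !y)))]
  simp only [fun p₁ p₂ => sum_crossingState y fun q₁ q₂ => F₁ p₁ p₂ * F₂ q₁ q₂ *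
        L (orderedMul c₁ (pairMatrix S p₁) (pairMatrix S q₁))
          (orderedMul c₂ (pairMatrix S p₂) (pairMatrix S q₂))]
  rw [Finset.sum_congr rfl fun p₁ _ => Finset.sum_comm]
  rw [sum_orderedMul c₁ (fun p₁ q₁ X => ∑ p₂, ∑ q₂, F₁ p₁ p₂ * F₂ q₁ q₂ *
    L X (orderedMul c₂ (pairMatrix S p₂) (pairMatrix S q₂))) (by simp [h₁])]
  simp only [fun p₁ q₁ X => sum_orderedMul c₂ (fun p₂ q₂ Y => F₁ p₁ p₂ * F₂ q₁ q₂ *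
    L X Y) (by simp [h₂])]
  simp only [Finset.sum_mul, ← Fintype.sum_prod_type']
  refine Fintype.sum_equiv ⟨fun ⟨i₁, m₁, o₁, i₂, m₂, o₂⟩ => ⟨i₁, o₁, i₂, o₂, m₁, m₂⟩,
    fun ⟨i₁, o₁, i₂, o₂, m₁, m₂⟩ => ⟨i₁, m₁, o₁, i₂, m₂, o₂⟩, fun _ => rfl, fun _ => rfl⟩ _ _
    fun _ => rfl

theorem sum_leg_three {S : Type*} [CommRing S]
    (F₁ F₂ F₃ : Colour × Colour → Colour × Colour → S) (x y z c₁ c₂ c₃ : Bool)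
    (L : Matrix Colour Colour S → Matrix Colour Colour S → Matrix Colour Colour S → S)
    (h₁ : ∀ Y Z, L 0 Y Z = 0) (h₂ : ∀ X Z, L X 0 Z = 0) (h₃ : ∀ X Y, L X Y 0 = 0) :
    ∑ v₁ : CrossingState, ∑ v₂ : CrossingState, ∑ v₃ : CrossingState,
        F₁ (v₁ x) (v₁ !x) * F₂ (v₂ y) (v₂ !y) * F₃ (v₃ z) (v₃ !z) *
        L (orderedMul c₁ (pairMatrix S (v₁ x)) (pairMatrix S (v₂ y)))
          (orderedMul c₂ (pairMatrix S (v₁ !x)) (pairMatrix S (v₃ z)))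
          (orderedMul c₃ (pairMatrix S (v₂ !y)) (pairMatrix S (v₃ !z))) =
      ∑ i₁, ∑ o₁, ∑ i₂, ∑ o₂, ∑ i₃, ∑ o₃, (∑ m₁, ∑ m₂, ∑ m₃,
        F₁ (leg c₁ i₁ m₁ o₁) (leg c₂ i₂ m₂ o₂) * F₂ (leg (!c₁) i₁ m₁ o₁) (leg c₃ i₃ m₃ o₃) *
        F₃ (leg (!c₂) i₂ m₂ o₂) (leg (!c₃) i₃ m₃ o₃)) *
        L (Matrix.single i₁ o₁ 1) (Matrix.single i₂ o₂ 1) (Matrix.single i₃ o₃ 1) := by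
  rw [sum_crossingState x fun p₁ p₂ => ∑ v₂ : CrossingState, ∑ v₃ : CrossingState,
        F₁ p₁ p₂ * F₂ (v₂ y) (v₂ !y) * F₃ (v₃ z) (v₃ !z) *
        L (orderedMul c₁ (pairMatrix S p₁) (pairMatrix S (v₂ y)))
          (orderedMul c₂ (pairMatrix S p₂) (pairMatrix S (v₃ z)))
          (orderedMul c₃ (pairMatrix S (v₂ !y)) (pairMatrix S (v₃ !z)))]
  simp only [fun p₁ p₂ => sum_crossingState y fun q₁ q₂ => ∑ v₃ : CrossingState,
        F₁ p₁ p₂ * F₂ q₁ q₂ * F₃ (v₃ z) (v₃ !z) *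
        L (orderedMul c₁ (pairMatrix S p₁) (pairMatrix S q₁))
          (orderedMul c₂ (pairMatrix S p₂) (pairMatrix S (v₃ z)))
          (orderedMul c₃ (pairMatrix S q₂) (pairMatrix S (v₃ !z)))]
  simp only [fun p₁ p₂ q₁ q₂ => sum_crossingState z fun r₁ r₂ =>
        F₁ p₁ p₂ * F₂ q₁ q₂ * F₃ r₁ r₂ *
        L (orderedMul c₁ (pairMatrix S p₁) (pairMatrix S q₁))
          (orderedMul c₂ (pairMatrix S p₂) (pairMatrix S r₁))
          (orderedMul c₃ (pairMatrix S q₂) (pairMatrix S r₂))]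
  rw [Finset.sum_congr rfl fun p₁ _ => Finset.sum_comm]
  simp only [fun p₁ q₁ p₂ => Finset.sum_comm (s := Finset.univ) (t := Finset.univ)
        (f := fun q₂ r₁ => ∑ r₂, F₁ p₁ p₂ * F₂ q₁ q₂ * F₃ r₁ r₂ *
        L (orderedMul c₁ (pairMatrix S p₁) (pairMatrix S q₁))
          (orderedMul c₂ (pairMatrix S p₂) (pairMatrix S r₁))
          (orderedMul c₃ (pairMatrix S q₂) (pairMatrix S r₂)))]
  rw [sum_orderedMul c₁ (fun p₁ q₁ X => ∑ p₂, ∑ r₁, ∑ q₂, ∑ r₂, F₁ p₁ p₂ * F₂ q₁ q₂ *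
    F₃ r₁ r₂ * L X (orderedMul c₂ (pairMatrix S p₂) (pairMatrix S r₁))
      (orderedMul c₃ (pairMatrix S q₂) (pairMatrix S r₂))) (by simp [h₁])]
  simp only [fun p₁ q₁ X => sum_orderedMul c₂ (fun p₂ r₁ Y => ∑ q₂, ∑ r₂, F₁ p₁ p₂ *
    F₂ q₁ q₂ * F₃ r₁ r₂ * L X Y (orderedMul c₃ (pairMatrix S q₂) (pairMatrix S r₂)))
    (by simp [h₂])]
  simp only [fun p₁ q₁ p₂ r₁ X Y => sum_orderedMul c₃ (fun q₂ r₂ Z => F₁ p₁ p₂ *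
    F₂ q₁ q₂ * F₃ r₁ r₂ * L X Y Z) (by simp [h₃])]
  simp only [Finset.sum_mul, ← Fintype.sum_prod_type']
  refine Fintype.sum_equiv ⟨fun ⟨i₁, m₁, o₁, i₂, m₂, o₂, i₃, m₃, o₃⟩ =>
      ⟨i₁, o₁, i₂, o₂, i₃, o₃, m₁, m₂, m₃⟩, fun ⟨i₁, o₁, i₂, o₂, i₃, o₃, m₁, m₂, m₃⟩ =>
      ⟨i₁, m₁, o₁, i₂, m₂, o₂, i₃, m₃, o₃⟩, fun _ => rfl, fun _ => rfl⟩ _ _ fun _ => rfl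

end Strands

theorem sum_single_self_mul {S : Type*} [CommRing S] (U : Matrix Colour Colour S) :
    ∑ i, (Matrix.single i i 1 * U) = U := by
  rw [← Finset.sum_mul, Matrix.sum_single_one, one_mul]

/-! ### Invariance of the state sum -/

/-- The strands of a code: the names of the crossings with the sides of the passages. -/
def keys (w : Code) : List (ℕ × Bool) := w.map fun l => (l.crossing, l.left)

theorem keys_perm {w w' : Code} (h : w.Perm w') : (keys w).Perm (keys w') := h.map _

theorem leftNames_perm {w w' : Code} (h : w.Perm w') : (leftNames w).Perm (leftNames w') :=
  (h.filter _).map _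

theorem leftNames_pair (a : Passage) (w : Code) :
    leftNames (a :: a.partner :: w) = a.crossing :: leftNames w := by
  rcases a with ⟨c, _ | _, p⟩ <;> simp [leftNames, Passage.partner]

theorem ne_of_nodup_keys {a : Passage} {w : Code} (h : (keys (a :: a.partner :: w)).Nodup) :
    ∀ l ∈ w, l.crossing ≠ a.crossing := by
  intro l hl he
  simp only [keys, List.map_cons, List.nodup_cons, List.mem_cons, List.mem_map, not_or,
    not_exists, not_and] at h
  rcases Bool.eq_or_eq_not l.left a.left with hb | hb
  · exact h.1.2 l hl (by rw [he, hb])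
  · exact h.2.1 l hl (by rw [he, hb]; rfl)

theorem nodup_keys_tail {a b : Passage} {w : Code} (h : (keys (a :: b :: w)).Nodup) :
    (keys w).Nodup := by
  simp only [keys, List.map_cons, List.nodup_cons] at h
  exact h.2.2

theorem map_passageWeight_update {w : Code} {k : ℕ} (h : ∀ l ∈ w, l.crossing ≠ k)
    (f : ℕ → CrossingState) (v : CrossingState) :
    w.map (passageWeight (Function.update f k v)) = w.map (passageWeight f) :=
  List.map_congr_left fun l hl => by simp [passageWeight, Function.update_of_ne (h l hl)]

theorem map_passageMatrix_update {w : Code} {k : ℕ} (h : ∀ l ∈ w, l.crossing ≠ k)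
    (f : ℕ → CrossingState) (v : CrossingState) :
    w.map (passageMatrix (Function.update f k v)) = w.map (passageMatrix f) :=
  List.map_congr_left fun l hl => by simp [passageMatrix, Function.update_of_ne (h l hl)]

theorem passageWeight_mul_partner (f : ℕ → CrossingState) {a : Passage} (h : a.pass ≠ .virt) :
    passageWeight f a * passageWeight f a.partner =
      crossingWeight a.positive (f a.crossing) := by
  have hp := a.positive_partner h
  have hl : a.partner.left = !a.left := rfl
  have hc : a.partner.crossing = a.crossing := rfl
  rw [passageWeight, passageWeight, hp, hl, hc]
  cases a.left <;> simp

theorem stateSum_rotate (u v : Code) : stateSum (u ++ v) = stateSum (v ++ u) := by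
  rw [stateSum, iterSum_perm _ (leftNames_perm List.perm_append_comm), stateSum]
  congr 1
  funext f
  simp only [colouringWeight, List.map_append, List.prod_append]
  rw [mul_comm (List.prod _), Matrix.trace_mul_comm]

theorem stateSum_rename {σ : ℕ → ℕ} (hσ : σ.Injective) (w : Code) :
    stateSum (w.map (Passage.rename σ)) = stateSum w := by
  have h : leftNames (w.map (Passage.rename σ)) = (leftNames w).map σ := by
    simp only [leftNames, List.filter_map, List.map_map]
    rfl
  rw [stateSum, h]
  refine Eq.trans ?_ (iterSum_map _ hσ (leftNames w) (colouringWeight w))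
  congr 1
  funext f
  simp only [colouringWeight, List.map_map]
  rfl

theorem sum_kink (s b : Bool) (P : StateRing) (U : Matrix Colour Colour StateRing) :
    ∑ v : CrossingState, sideWeight s b (v b) (v !b) *
      (P * (pairMatrix StateRing (v b) * pairMatrix StateRing (v !b) * U).trace) =
      scalar (if s then 7 else 8) * (P * U.trace) := by
  rw [sum_crossingState b fun p q => sideWeight s b p q *
    (P * (pairMatrix StateRing p * pairMatrix StateRing q * U).trace)]
  have e := sum_orderedMul true (fun p q X => sideWeight s b p q * (P * (X * U).trace))
    (by simp)
  simp only [orderedMul, leg, if_true, Bool.not_true, Bool.false_eq_true, if_false] at e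
  rw [e]
  simp only [fun i => Finset.sum_comm (s := Finset.univ) (t := Finset.univ) (f := fun m o =>
    sideWeight s b (i, m) (m, o) * (P * (Matrix.single i o 1 * U).trace))]
  simp only [← Finset.sum_mul, sideWeight_kink, mul_ite, mul_one, mul_zero, ite_mul, zero_mul,
    Finset.sum_ite_eq, Finset.mem_univ, if_true]
  rw [← Finset.mul_sum, ← Finset.mul_sum, ← Matrix.trace_sum, sum_single_self_mul]

theorem stateSum_kink {a : Passage} {w : Code} (ha : a.pass ≠ .virt)
    (h : (keys (a :: a.partner :: w)).Nodup) :
    stateSum (a :: a.partner :: w) = scalar (if a.positive then 7 else 8) * stateSum w := by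
  have hw := ne_of_nodup_keys h
  rw [stateSum, leftNames_pair, iterSum, stateSum, ← iterSum_mul]
  congr 1
  funext f
  have key : ∀ v, colouringWeight (a :: a.partner :: w) (Function.update f a.crossing v) =
      sideWeight a.positive a.left (v a.left) (v !a.left) *
        ((w.map (passageWeight f)).prod * (pairMatrix StateRing (v a.left) *
            pairMatrix StateRing (v !a.left) *
          (w.map (passageMatrix f)).prod).trace) := by
    intro v
    have hm : passageMatrix (Function.update f a.crossing v) a =
        pairMatrix StateRing (v a.left) := by
      simp [passageMatrix, pairMatrix]
    have hm' : passageMatrix (Function.update f a.crossing v) a.partner =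
        pairMatrix StateRing (v !a.left) := by
      simp [passageMatrix, pairMatrix, Passage.partner]
    simp only [colouringWeight, List.map_cons, List.prod_cons, map_passageWeight_update hw,
      map_passageMatrix_update hw, hm, hm']
    rw [← crossingWeight_eq_sideWeight, ← mul_assoc, ← mul_assoc, passageWeight_mul_partner _ ha,
      Function.update_self, Matrix.mul_assoc, mul_assoc]
  rw [Finset.sum_congr rfl fun v _ => key v, sum_kink]
  rfl

/-- The two passages in one of the two orders. -/
theorem ordered_perm (c : Bool) (a b : Passage) : (ordered c a b).Perm [a, b] := by
  cases c
  · exact List.Perm.swap _ _ _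
  · exact List.Perm.refl _

theorem prod_map_ordered {M : Type*} [CommMonoid M] (g : Passage → M) (c : Bool)
    (a b : Passage) : ((ordered c a b).map g).prod = g a * g b := by
  cases c <;> simp [ordered, mul_comm]

theorem prod_passageMatrix_ordered (f : ℕ → CrossingState) (c : Bool) (a b : Passage) :
    ((ordered c a b).map (passageMatrix f)).prod =
      orderedMul c (pairMatrix StateRing (f a.crossing a.left))
          (pairMatrix StateRing (f b.crossing b.left)) := by
  cases c <;> simp [ordered, orderedMul, passageMatrix, pairMatrix]

theorem stateSum_bigon {a b : Passage} {u v : Code} (c : Bool) (ha : a.pass ≠ .virt)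
    (hp : a.pass = b.pass) (hs : a.left ≠ b.left)
    (h : (keys ([a, b] ++ u ++ ordered c a.partner b.partner ++ v)).Nodup) :
    stateSum ([a, b] ++ u ++ ordered c a.partner b.partner ++ v) = stateSum (u ++ v) := by
  have hb : b.pass ≠ .virt := hp ▸ ha
  have perm : ([a, b] ++ u ++ ordered c a.partner b.partner ++ v).Perm
      (a :: a.partner :: b :: b.partner :: (u ++ v)) := by
    refine ((((ordered_perm c a.partner b.partner).append_left ([a, b] ++ u)).append_right
      v)).trans ?_
    classical
    rw [List.perm_iff_count]
    intro l
    simp only [List.count_append, List.count_cons, List.count_nil]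
    omega
  rw [(keys_perm perm).nodup_iff] at h
  have hna := ne_of_nodup_keys h
  have hnb := ne_of_nodup_keys (nodup_keys_tail h)
  have hba : b.crossing ≠ a.crossing := hna b (by simp)
  have hna' : ∀ l ∈ u ++ v, l.crossing ≠ a.crossing := fun l hl => hna l (by simp [hl])
  have hau : ∀ l ∈ u, l.crossing ≠ a.crossing := fun l hl => hna l (by simp [hl])
  have hav : ∀ l ∈ v, l.crossing ≠ a.crossing := fun l hl => hna l (by simp [hl])
  have hbu : ∀ l ∈ u, l.crossing ≠ b.crossing := fun l hl => hnb l (by simp [hl])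
  have hbv : ∀ l ∈ v, l.crossing ≠ b.crossing := fun l hl => hnb l (by simp [hl])
  rw [stateSum, iterSum_perm _ (leftNames_perm perm), leftNames_pair, leftNames_pair, iterSum,
    iterSum, stateSum]
  congr 1
  funext f
  have hpos : b.positive = !a.positive := by
    unfold Passage.positive
    rw [hp]
    cases hx : a.left <;> cases hy : b.left <;> simp_all
  have hbl : b.left = !a.left := by
    cases hx : a.left <;> cases hy : b.left <;> simp_all
  have key : ∀ y x, colouringWeight ([a, b] ++ u ++ ordered c a.partner b.partner ++ v)
      (Function.update (Function.update f b.crossing y) a.crossing x) =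
      sideWeight a.positive a.left (x a.left) (x !a.left) *
      sideWeight b.positive b.left (y b.left) (y !b.left) *
      (((u ++ v).map (passageWeight f)).prod *
        (orderedMul true (pairMatrix StateRing (x a.left)) (pairMatrix StateRing (y b.left)) *
          (u.map (passageMatrix f)).prod *
          orderedMul c (pairMatrix StateRing (x !a.left)) (pairMatrix StateRing (y !b.left)) *
          (v.map (passageMatrix f)).prod).trace) := by
    intro y x
    rw [← crossingWeight_eq_sideWeight, ← crossingWeight_eq_sideWeight]
    simp only [colouringWeight, List.map_append, List.prod_append, map_passageWeight_update hau,
      map_passageWeight_update hav, map_passageMatrix_update hau, map_passageMatrix_update hav,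
      map_passageWeight_update hbu, map_passageWeight_update hbv, map_passageMatrix_update hbu,
      map_passageMatrix_update hbv, prod_map_ordered, prod_passageMatrix_ordered]
    set g := Function.update (Function.update f b.crossing y) a.crossing x with hg
    have ga : g a.crossing = x := by simp [hg]
    have gb : g b.crossing = y := by simp [hg, hba]
    have e1 := passageWeight_mul_partner g ha
    have e2 := passageWeight_mul_partner g hb
    rw [ga] at e1
    rw [gb] at e2
    rw [← e1, ← e2]
    have hca : a.partner.crossing = a.crossing := rfl
    have hcb : b.partner.crossing = b.crossing := rfl
    have hla : a.partner.left = !a.left := rfl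
    have hlb : b.partner.left = !b.left := rfl
    simp only [hca, hcb, hla, hlb, ga, gb, passageMatrix, List.map_cons, List.map_nil,
      List.prod_cons, List.prod_nil, mul_one, orderedMul, if_true, pairMatrix]
    ring
  simp only [key]
  rw [Finset.sum_comm]
  refine (sum_leg_two (sideWeight a.positive a.left) (sideWeight b.positive b.left) a.left b.left
    true c (fun X Y => ((u ++ v).map (passageWeight f)).prod *
        (X * (u.map (passageMatrix f)).prod * Y * (v.map (passageMatrix f)).prod).trace)
    (by simp) (by simp)).trans ?_
  rw [hpos, hbl]
  simp only [Bool.not_true, sideWeight_bigon, ite_and, ite_mul, one_mul, zero_mul,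
    Finset.sum_ite_irrel, Finset.sum_const_zero, Finset.sum_ite_eq, Finset.mem_univ, if_true]
  simp only [← Finset.mul_sum, ← Matrix.trace_sum, ← Finset.sum_mul]
  simp only [Matrix.sum_single_one, mul_one, one_mul, colouringWeight,
    List.map_append, List.prod_append]

theorem sum_triangle (s₁ s₂ s₃ x y z : Bool)
    (h : (s₁ == (y == z)) = (s₃ == ((y == z) == (x == z))) →
      (s₂ == (x == z)) = (s₁ == (y == z)))
    (P : StateRing) (U V W : Matrix Colour Colour StateRing) :
    ∑ v₁ : CrossingState, ∑ v₂ : CrossingState, ∑ v₃ : CrossingState,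
      sideWeight s₁ x (v₁ x) (v₁ !x) * sideWeight s₂ y (v₂ y) (v₂ !y) *
        sideWeight s₃ z (v₃ z) (v₃ !z) * (P *
        (orderedMul true (pairMatrix StateRing (v₁ x)) (pairMatrix StateRing (v₂ y)) * U *
          orderedMul (y == z) (pairMatrix StateRing (v₁ !x)) (pairMatrix StateRing (v₃ z)) * V *
          orderedMul (x == z) (pairMatrix StateRing (v₂ !y)) (pairMatrix StateRing (v₃ !z)) *
          W).trace) =
    ∑ v₁ : CrossingState, ∑ v₂ : CrossingState, ∑ v₃ : CrossingState,
      sideWeight s₁ x (v₁ x) (v₁ !x) * sideWeight s₂ y (v₂ y) (v₂ !y) *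
        sideWeight s₃ z (v₃ z) (v₃ !z) * (P *
        (orderedMul false (pairMatrix StateRing (v₁ x)) (pairMatrix StateRing (v₂ y)) * U *
          orderedMul (!(y == z)) (pairMatrix StateRing (v₁ !x)) (pairMatrix StateRing (v₃ z)) * V *
          orderedMul (!(x == z)) (pairMatrix StateRing (v₂ !y)) (pairMatrix StateRing (v₃ !z)) *
          W).trace) := by
  have sum := fun c₁ c₂ c₃ => sum_leg_three (sideWeight s₁ x) (sideWeight s₂ y)
      (sideWeight s₃ z) x y z c₁ c₂ c₃
      (fun X Y Z => P * (X * U * Y * V * Z * W).trace) (by simp) (by simp) (by simp)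
  refine (sum true (y == z) (x == z)).trans (Eq.trans ?_ (sum false (!(y == z)) (!(x == z))).symm)
  simp only [Bool.not_true, Bool.not_false, Bool.not_not, sideWeight_triangle _ _ _ _ _ _ h]

theorem stateSum_triangle {x y z : Passage} {u v w : Code} (hx : x.pass ≠ .virt)
    (hy : y.pass ≠ .virt) (hz : z.pass ≠ .virt) (hp : x.pass = z.pass → y.pass = x.pass)
    (h : (keys ([x, y] ++ u ++ ordered (y.left == z.left) x.partner z ++ v ++
          ordered (x.left == z.left) y.partner z.partner ++ w)).Nodup) :
    stateSum ([x, y] ++ u ++ ordered (y.left == z.left) x.partner z ++ v ++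
          ordered (x.left == z.left) y.partner z.partner ++ w) =
      stateSum ([y, x] ++ u ++ ordered (y.left == z.left) z x.partner ++ v ++
          ordered (x.left == z.left) z.partner y.partner ++ w) := by
  have perm : ∀ a₁ a₂ b₁ b₂ c₁ c₂ d₁ d₂,
      [a₁, a₂].Perm [x, y] → [b₁, b₂].Perm [x.partner, z] →
      [d₁, d₂].Perm [y.partner, z.partner] →
      ([a₁, a₂] ++ u ++ ordered c₁ b₁ b₂ ++ v ++ ordered c₂ d₁ d₂ ++ w).Perm
      (x :: x.partner :: y :: y.partner :: z :: z.partner :: (u ++ v ++ w)) := by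
    intro a₁ a₂ b₁ b₂ c₁ c₂ d₁ d₂ p₁ p₂ p₃
    refine (((((p₁.append_right u).append ((ordered_perm c₁ b₁ b₂).trans p₂)).append_right
      v).append ((ordered_perm c₂ d₁ d₂).trans p₃)).append_right w).trans ?_
    classical
    rw [List.perm_iff_count]
    intro l
    simp only [List.count_append, List.count_cons, List.count_nil]
    omega
  have perm₁ := perm x y x.partner z (y.left == z.left) (x.left == z.left) y.partner z.partner
    (.refl _) (.refl _) (.refl _)
  have perm₂ := perm y x z x.partner (y.left == z.left) (x.left == z.left) z.partner y.partner
    (.swap _ _ _) (.swap _ _ _) (.swap _ _ _)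
  rw [(keys_perm perm₁).nodup_iff] at h
  have hnx := ne_of_nodup_keys h
  have hny := ne_of_nodup_keys (nodup_keys_tail h)
  have hnz := ne_of_nodup_keys (nodup_keys_tail (nodup_keys_tail h))
  have hyx : y.crossing ≠ x.crossing := hnx y (by simp)
  have hzx : z.crossing ≠ x.crossing := hnx z (by simp)
  have hzy : z.crossing ≠ y.crossing := hny z (by simp)
  have hxu : ∀ l ∈ u, l.crossing ≠ x.crossing := fun l hl => hnx l (by simp [hl])
  have hxv : ∀ l ∈ v, l.crossing ≠ x.crossing := fun l hl => hnx l (by simp [hl])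
  have hxw : ∀ l ∈ w, l.crossing ≠ x.crossing := fun l hl => hnx l (by simp [hl])
  have hyu : ∀ l ∈ u, l.crossing ≠ y.crossing := fun l hl => hny l (by simp [hl])
  have hyv : ∀ l ∈ v, l.crossing ≠ y.crossing := fun l hl => hny l (by simp [hl])
  have hyw : ∀ l ∈ w, l.crossing ≠ y.crossing := fun l hl => hny l (by simp [hl])
  have hzu : ∀ l ∈ u, l.crossing ≠ z.crossing := fun l hl => hnz l (by simp [hl])
  have hzv : ∀ l ∈ v, l.crossing ≠ z.crossing := fun l hl => hnz l (by simp [hl])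
  have hzw : ∀ l ∈ w, l.crossing ≠ z.crossing := fun l hl => hnz l (by simp [hl])
  rw [stateSum, iterSum_perm _ (leftNames_perm perm₁), stateSum,
    iterSum_perm _ (leftNames_perm perm₂), leftNames_pair, leftNames_pair, leftNames_pair]
  refine congrArg (iterSum _ (leftNames (u ++ v ++ w))) (funext fun f => ?_)
  have key : ∀ (r q p : CrossingState) (c₁ c₂ c₃ : Bool),
      colouringWeight (ordered c₁ x y ++ u ++ ordered c₂ x.partner z ++ v ++
          ordered c₃ y.partner z.partner ++ w)
        (Function.update (Function.update (Function.update f z.crossing r) y.crossing q)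
          x.crossing p) =
      sideWeight x.positive x.left (p x.left) (p !x.left) *
      sideWeight y.positive y.left (q y.left) (q !y.left) *
      sideWeight z.positive z.left (r z.left) (r !z.left) *
      (((u ++ v ++ w).map (passageWeight f)).prod *
        (orderedMul c₁ (pairMatrix StateRing (p x.left)) (pairMatrix StateRing (q y.left)) *
          (u.map (passageMatrix f)).prod *
          orderedMul c₂ (pairMatrix StateRing (p !x.left)) (pairMatrix StateRing (r z.left)) *
          (v.map (passageMatrix f)).prod *
          orderedMul c₃ (pairMatrix StateRing (q !y.left)) (pairMatrix StateRing (r !z.left)) *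
          (w.map (passageMatrix f)).prod).trace) := by
    intro r q p c₁ c₂ c₃
    rw [← crossingWeight_eq_sideWeight, ← crossingWeight_eq_sideWeight,
      ← crossingWeight_eq_sideWeight]
    simp only [colouringWeight, List.map_append, List.prod_append, map_passageWeight_update hxu,
      map_passageWeight_update hxv, map_passageWeight_update hxw, map_passageMatrix_update hxu,
      map_passageMatrix_update hxv, map_passageMatrix_update hxw, map_passageWeight_update hyu,
      map_passageWeight_update hyv, map_passageWeight_update hyw, map_passageMatrix_update hyu,
      map_passageMatrix_update hyv, map_passageMatrix_update hyw, map_passageWeight_update hzu,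
      map_passageWeight_update hzv, map_passageWeight_update hzw, map_passageMatrix_update hzu,
      map_passageMatrix_update hzv, map_passageMatrix_update hzw, prod_map_ordered,
      prod_passageMatrix_ordered]
    set g := Function.update (Function.update (Function.update f z.crossing r) y.crossing q)
          x.crossing p with hg
    have gx : g x.crossing = p := by simp [hg]
    have gy : g y.crossing = q := by simp [hg, hyx]
    have gz : g z.crossing = r := by simp [hg, hzx, hzy]
    have e1 := passageWeight_mul_partner g hx
    have e2 := passageWeight_mul_partner g hy
    have e3 := passageWeight_mul_partner g hz
    rw [gx] at e1
    rw [gy] at e2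
    rw [gz] at e3
    rw [← e1, ← e2, ← e3]
    have hcx : x.partner.crossing = x.crossing := rfl
    have hcy : y.partner.crossing = y.crossing := rfl
    have hcz : z.partner.crossing = z.crossing := rfl
    have hlx : x.partner.left = !x.left := rfl
    have hly : y.partner.left = !y.left := rfl
    have hlz : z.partner.left = !z.left := rfl
    simp only [hcx, hcy, hcz, hlx, hly, hlz, gx, gy, gz]
    ring
  have swap : ∀ c a b, ordered c a b = ordered (!c) b a := by
    intro c a b
    cases c <;> rfl
  have hl : [x, y] = ordered true x y := rfl
  have hr : [y, x] = ordered false x y := rfl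
  have hsigns : (x.positive == (y.left == z.left)) =
        (z.positive == ((y.left == z.left) == (x.left == z.left))) →
      (y.positive == (x.left == z.left)) = (x.positive == (y.left == z.left)) := by
    revert hx hy hz hp
    rcases x with ⟨_, _ | _, _ | _ | _⟩ <;> rcases y with ⟨_, _ | _, _ | _ | _⟩ <;>
      rcases z with ⟨_, _ | _, _ | _ | _⟩ <;> simp [Passage.positive]
  rw [hl, hr, swap _ z x.partner, swap _ z.partner y.partner]
  simp only [key]
  have rev : ∀ F : CrossingState → CrossingState → CrossingState → StateRing,
      ∑ r, ∑ q, ∑ p, F p q r = ∑ p, ∑ q, ∑ r, F p q r := by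
    intro F
    rw [Finset.sum_congr rfl fun r _ => Finset.sum_comm, Finset.sum_comm,
      Finset.sum_congr rfl fun p _ => Finset.sum_comm]
  refine (rev _).trans (Eq.trans ?_ (rev _).symm)
  exact sum_triangle _ _ _ _ _ _ hsigns _ _ _ _

/-! ### Moves -/

theorem nodup_keys_gaussCode {w : Code} (h : Valid w) : (keys (gaussCode w)).Nodup :=
  h.1.sublist (List.filter_sublist.map _)

theorem gaussCode_append (u v : Code) : gaussCode (u ++ v) = gaussCode u ++ gaussCode v :=
  List.filter_append _ _

theorem gaussCode_cons_virt {a : Passage} (h : a.pass = .virt) (w : Code) :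
    gaussCode (a :: w) = gaussCode w := by
  simp [gaussCode, h]

theorem gaussCode_cons {a : Passage} (h : a.pass ≠ .virt) (w : Code) :
    gaussCode (a :: w) = a :: gaussCode w := by
  simp [gaussCode, h]

theorem partner_pass_eq_virt {a : Passage} : a.partner.pass = .virt ↔ a.pass = .virt := by
  rcases a with ⟨_, _, _ | _ | _⟩ <;> simp [Passage.partner, Pass.opposite]

theorem gaussCode_ordered {c : Bool} {a b : Passage} (ha : a.pass ≠ .virt)
    (hb : b.pass ≠ .virt) : gaussCode (ordered c a b) = ordered c a b := by
  cases c <;> simp [ordered, gaussCode, ha, hb]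

theorem gaussCode_ordered_swap {c : Bool} {a b : Passage} (h : a.pass = .virt ∨ b.pass = .virt) :
    gaussCode (ordered c a b) = gaussCode (ordered c b a) := by
  cases c <;> rcases h with h | h <;> simp [ordered, gaussCode, List.filter_cons, h]

theorem gaussCode_swap {a b : Passage} (h : a.pass = .virt ∨ b.pass = .virt) :
    gaussCode [a, b] = gaussCode [b, a] :=
  gaussCode_ordered_swap (c := true) h

/-- The state sum of the Gauss code is, up to a unit, invariant under the moves. -/
theorem Move.stateSum_eq {w w' : Code} (h : Move w w') (hw : Valid w) :
    ∃ c : (ZMod 11)ˣ, stateSum (gaussCode w) = scalar (c : ZMod 11) * stateSum (gaussCode w') := by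
  have hn := nodup_keys_gaussCode hw
  have one : ∀ {s s' : StateRing}, s = s' → ∃ c : (ZMod 11)ˣ, s = scalar (c : ZMod 11) * s' :=
    fun h => ⟨1, by simp [h]⟩
  cases h with
  | rotate u v =>
    rw [gaussCode_append, gaussCode_append]
    exact one (stateSum_rotate _ _)
  | rename f hf w =>
    refine one (Eq.symm ?_)
    have : gaussCode (w.map (Passage.rename f)) = (gaussCode w).map (Passage.rename f) := by
      simp only [gaussCode, List.filter_map]
      rfl
    rw [this, stateSum_rename hf]
  | r1 a w =>
    by_cases ha : a.pass = .virt
    · rw [gaussCode_cons_virt ha, gaussCode_cons_virt (partner_pass_eq_virt.2 ha)]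
      exact one rfl
    · rw [gaussCode_cons ha, gaussCode_cons (mt partner_pass_eq_virt.1 ha)] at hn ⊢
      rw [stateSum_kink ha hn]
      cases a.positive
      · exact ⟨⟨8, 7, by decide, by decide⟩, rfl⟩
      · exact ⟨⟨7, 8, by decide, by decide⟩, rfl⟩
  | r2 a b u v hp hs =>
    by_cases ha : a.pass = .virt
    · have hb : b.pass = .virt := hp ▸ ha
      simp only [gaussCode_append, gaussCode_cons_virt, ha, hb, partner_pass_eq_virt.2]
      exact one (by simp [gaussCode])
    · have hb : b.pass ≠ .virt := hp ▸ ha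
      have e : gaussCode ([a, b] ++ u ++ [a.partner, b.partner] ++ v) =
          [a, b] ++ gaussCode u ++ ordered true a.partner b.partner ++ gaussCode v := by
        simp only [gaussCode_append, gaussCode_cons, ha, hb, partner_pass_eq_virt, ne_eq,
          not_false_eq_true]
        rfl
      rw [e] at hn ⊢
      rw [gaussCode_append]
      exact one (stateSum_bigon true ha hp hs hn)
  | r2' a b u v hp hs =>
    by_cases ha : a.pass = .virt
    · have hb : b.pass = .virt := hp ▸ ha
      simp only [gaussCode_append, gaussCode_cons_virt, ha, hb, partner_pass_eq_virt.2]
      exact one (by simp [gaussCode])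
    · have hb : b.pass ≠ .virt := hp ▸ ha
      have e : gaussCode ([a, b] ++ u ++ [b.partner, a.partner] ++ v) =
          [a, b] ++ gaussCode u ++ ordered false a.partner b.partner ++ gaussCode v := by
        simp only [gaussCode_append, gaussCode_cons, ha, hb, partner_pass_eq_virt, ne_eq,
          not_false_eq_true]
        rfl
      rw [e] at hn ⊢
      rw [gaussCode_append]
      exact one (stateSum_bigon false ha hp hs hn)
  | r3 x y z u v w ht =>
    by_cases hc : x.pass ≠ .virt ∧ y.pass ≠ .virt ∧ z.pass ≠ .virt
    · obtain ⟨hx, hy, hz⟩ := hc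
      have hp : x.pass = z.pass → y.pass = x.pass := by
        simp only [TriangleAllowed, hx, hy, hz, and_false, false_or] at ht
        exact ht.2.2.2
      have hx' := mt partner_pass_eq_virt.1 hx
      have hy' := mt partner_pass_eq_virt.1 hy
      have hz' := mt partner_pass_eq_virt.1 hz
      have e₁ : gaussCode [x, y] = [x, y] := gaussCode_ordered (c := true) hx hy
      have e₂ : gaussCode [y, x] = [y, x] := gaussCode_ordered (c := true) hy hx
      simp only [gaussCode_append, gaussCode_ordered, e₁, e₂, hz, hx', hy', hz', ne_eq,
        not_false_eq_true] at hn ⊢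
      exact one (stateSum_triangle hx hy hz hp hn)
    · have hv : (x.pass = .virt ∨ y.pass = .virt) ∧ (x.pass = .virt ∨ z.pass = .virt) ∧
          (y.pass = .virt ∨ z.pass = .virt) := by
        unfold TriangleAllowed at ht
        tauto
      obtain ⟨h₁, h₂, h₃⟩ := hv
      simp only [gaussCode_append]
      rw [gaussCode_swap h₁,
        gaussCode_ordered_swap (a := x.partner) (b := z) (by rwa [partner_pass_eq_virt]),
        gaussCode_ordered_swap (a := y.partner) (b := z.partner)
          (by rwa [partner_pass_eq_virt, partner_pass_eq_virt])]
      exact one rfl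

theorem Equivalent.stateSum_eq {D E : Diagram} (h : Equivalent D E) :
    ∃ c : (ZMod 11)ˣ, stateSum (gaussCode D.code) = scalar (c : ZMod 11) *
        stateSum (gaussCode E.code) := by
  induction h with
  | rel D E h => exact h.stateSum_eq D.valid
  | refl D => exact ⟨1, by simp⟩
  | symm D E _ ih =>
    obtain ⟨c, hc⟩ := ih
    refine ⟨c⁻¹, ?_⟩
    rw [hc, ← mul_assoc, ← map_mul, Units.inv_mul, map_one, one_mul]
  | trans D E F _ _ ih ih' =>
    obtain ⟨c, hc⟩ := ih
    obtain ⟨d, hd⟩ := ih'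
    exact ⟨c * d, by rw [hc, hd, ← mul_assoc, ← map_mul, Units.val_mul]⟩

/-! ### Orbits -/

theorem exists_iterate_eq_self {α : Type*} {f : α → α} {s : Finset α} (hf : Set.MapsTo f s s)
    (hi : Set.InjOn f s) {d : α} (hd : d ∈ s) : ∃ p, 0 < p ∧ p ≤ s.card ∧ f^[p] d = d := by
  have hm : ∀ k, f^[k] d ∈ s := fun k => hf.iterate k hd
  obtain ⟨i, hi', j, hj', hij, he⟩ := Finset.exists_ne_map_eq_of_card_lt_of_maps_to
    (s := Finset.range (s.card + 1)) (t := s) (by simp) (f := fun k => f^[k] d) (fun k _ => hm k)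
  have aux : ∀ i j, i < j → j ≤ s.card → f^[i] d = f^[j] d →
      ∃ p, 0 < p ∧ p ≤ s.card ∧ f^[p] d = d := by
    intro i j hlt hj h
    refine ⟨j - i, by omega, by omega, ?_⟩
    have : f^[i] (f^[j - i] d) = f^[i] d := by
      rw [← Function.iterate_add_apply, h]
      congr 1
      omega
    exact (hi.iterate hf i) (hm _) hd this
  simp only [Finset.mem_range] at hi' hj'
  rcases lt_or_gt_of_ne hij with h | h
  · exact aux i j h (by omega) he
  · exact aux j i h (by omega) he.symm

theorem image_iterate_apply {α : Type*} [DecidableEq α] {f : α → α} {s : Finset α}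
    (hf : Set.MapsTo f s s) (hi : Set.InjOn f s) {d : α} (hd : d ∈ s) {N : ℕ} (hN : s.card ≤ N) :
    (Finset.range N).image (fun k => f^[k] (f d)) = (Finset.range N).image fun k => f^[k] d := by
  have key : ∀ e ∈ s, ∀ x, x ∈ (Finset.range N).image (fun k => f^[k] e) ↔ ∃ k, f^[k] e = x := by
    intro e he x
    obtain ⟨p, hp, hps, hpe⟩ := exists_iterate_eq_self hf hi he
    simp only [Finset.mem_image, Finset.mem_range]
    refine ⟨fun ⟨k, _, h⟩ => ⟨k, h⟩, fun ⟨k, h⟩ => ⟨k % p, (Nat.mod_lt _ hp).trans_le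
      (hps.trans hN), ?_⟩⟩
    rw [← h]
    exact Function.IsPeriodicPt.iterate_mod_apply hpe k
  ext x
  rw [key _ (hf hd), key _ hd]
  obtain ⟨p, hp, -, hpe⟩ := exists_iterate_eq_self hf hi hd
  refine ⟨fun ⟨k, h⟩ => ⟨k + 1, h⟩, fun ⟨k, h⟩ => ⟨k + (p - 1), ?_⟩⟩
  have e : (k + (p - 1)).succ = k + p := by omega
  rw [← Function.iterate_succ_apply, ← h, e, Function.iterate_add_apply, hpe]

/-! ### The cyclic order -/

theorem Valid.nodup {w : Code} (h : Valid w) : w.Nodup := List.Nodup.of_map _ h.1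

theorem next_mem {w : Code} {l : Passage} (h : l ∈ w) : next w l ∈ w := by
  have hw : 0 < w.length := List.length_pos_of_mem h
  rw [next, List.getD_eq_getElem _ _ (Nat.mod_lt _ hw)]
  exact List.getElem_mem _

theorem prev_mem {w : Code} {l : Passage} (h : l ∈ w) : prev w l ∈ w := by
  have hw : 0 < w.length := List.length_pos_of_mem h
  rw [prev, List.getD_eq_getElem _ _ (Nat.mod_lt _ hw)]
  exact List.getElem_mem _

theorem next_getElem {w : Code} (hw : w.Nodup) (i : ℕ) (hi : i < w.length) :
    next w w[i] = w[(i + 1) % w.length]'(Nat.mod_lt _ (by omega)) := by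
  rw [next, hw.idxOf_getElem, List.getD_eq_getElem _ _ (Nat.mod_lt _ (by omega))]

theorem prev_getElem {w : Code} (hw : w.Nodup) (i : ℕ) (hi : i < w.length) :
    prev w w[i] = w[(i + (w.length - 1)) % w.length]'(Nat.mod_lt _ (by omega)) := by
  rw [prev, hw.idxOf_getElem, List.getD_eq_getElem _ _ (Nat.mod_lt _ (by omega))]

theorem next_prev {w : Code} (hw : w.Nodup) {l : Passage} (h : l ∈ w) :
    next w (prev w l) = l := by
  obtain ⟨i, hi, rfl⟩ := List.getElem_of_mem h
  rw [prev_getElem hw, next_getElem hw]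
  congr 1
  rw [Nat.mod_add_mod, add_assoc, Nat.sub_add_cancel (by omega), Nat.add_mod_right,
    Nat.mod_eq_of_lt hi]

theorem prev_next {w : Code} (hw : w.Nodup) {l : Passage} (h : l ∈ w) :
    prev w (next w l) = l := by
  obtain ⟨i, hi, rfl⟩ := List.getElem_of_mem h
  rw [next_getElem hw, prev_getElem hw]
  congr 1
  rw [Nat.mod_add_mod, add_assoc, Nat.add_sub_cancel' (by omega), Nat.add_mod_right,
    Nat.mod_eq_of_lt hi]

theorem forall_of_next {w : Code} (hw : w.Nodup) {P : Passage → Prop} {l : Passage} (hl : l ∈ w)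
    (h₀ : P l) (h : ∀ m ∈ w, P m → P (next w m)) : ∀ m ∈ w, P m := by
  obtain ⟨i, hi, rfl⟩ := List.getElem_of_mem hl
  have key : ∀ k, P (w[(i + k) % w.length]'(Nat.mod_lt _ (by omega))) := by
    intro k
    induction k with
    | zero => simpa [Nat.mod_eq_of_lt hi] using h₀
    | succ k ih =>
      have := h _ (List.getElem_mem _) ih
      rw [next_getElem hw] at this
      simpa [Nat.mod_add_mod, add_assoc] using this
  intro m hm
  obtain ⟨j, hj, rfl⟩ := List.getElem_of_mem hm
  have := key (j + w.length - i)
  have e : (i + (j + w.length - i)) % w.length = j := by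
    rw [Nat.add_sub_cancel' (by omega), Nat.add_mod_right, Nat.mod_eq_of_lt hj]
  simpa only [e] using this

@[simp] theorem Passage.partner_partner (l : Passage) : l.partner.partner = l := by
  rcases l with ⟨c, b, _ | _ | _⟩ <;> simp [Passage.partner, Pass.opposite]

theorem mem_darts {w : Code} {d : Dart} : d ∈ darts w ↔ d.1 ∈ w := by
  simp [darts]

theorem card_darts {w : Code} (hw : w.Nodup) : (darts w).card = 2 * w.length := by
  rw [darts, Finset.card_product, List.toFinset_card_of_nodup hw, Finset.card_univ,
      Fintype.card_bool, mul_comm]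

theorem turnLeft_mapsTo {w : Code} (hw : Valid w) :
    Set.MapsTo (turnLeft w) (darts w) (darts w) := by
  intro d hd
  rw [Finset.mem_coe, mem_darts] at hd ⊢
  unfold turnLeft
  split_ifs
  · exact next_mem (hw.2 _ hd)
  · exact prev_mem (hw.2 _ hd)

theorem turnLeft_injOn {w : Code} (hw : Valid w) : Set.InjOn (turnLeft w) (darts w) := by
  rintro ⟨l, b⟩ hl ⟨m, c⟩ hm h
  rw [Finset.mem_coe, mem_darts] at hl hm
  have hl' := hw.2 _ hl
  have hm' := hw.2 _ hm
  have hn : next w l.partner = next w m.partner → l = m := fun e => by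
    rw [← l.partner_partner, ← prev_next hw.nodup hl', e, prev_next hw.nodup hm',
      m.partner_partner]
  have hp : prev w l.partner = prev w m.partner → l = m := fun e => by
    rw [← l.partner_partner, ← next_prev hw.nodup hl', e, next_prev hw.nodup hm',
      m.partner_partner]
  unfold turnLeft at h
  simp only at h
  split_ifs at h with h₁ h₂ h₂
  · have := hn (congrArg Prod.fst h)
    subst this
    rw [← h₁, ← h₂]
  · simp at h
  · simp at h
  · have := hp (congrArg Prod.fst h)
    subst this
    have : b = c := by
      revert h₁ h₂
      cases l.left <;> cases b <;> cases c <;> simp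
    rw [this]

/-- The face on the left of a directed edge. -/
theorem orbit_turnLeft {w : Code} (hw : Valid w) {d : Dart} (hd : d.1 ∈ w) :
    orbit w (turnLeft w) (turnLeft w d) = orbit w (turnLeft w) d :=
  image_iterate_apply (turnLeft_mapsTo hw) (turnLeft_injOn hw) (mem_darts.2 hd)
    (card_darts hw.nodup).le

/-! ### Alexander numberings of planar diagrams -/

section Alexander

variable {w : Code}

theorem length_le_two_mul_card_crossings (hw : Valid w) :
    w.length ≤ 2 * (crossings w).card := by
  rw [← List.toFinset_card_of_nodup hw.nodup]
  have h : crossings w = w.toFinset.image Passage.crossing := by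
    ext k
    simp [crossings]
  rw [h]
  refine Finset.card_le_mul_card_image _ _ fun k _ => ?_
  refine (Finset.card_le_card_of_injOn Passage.left (t := Finset.univ)
    (fun _ _ => Finset.mem_coe.2 (Finset.mem_univ _)) ?_).trans
    (by simp)
  intro l hl m hm hlm
  simp only [Finset.coe_filter, List.mem_toFinset, Set.mem_ofPred_eq] at hl hm
  exact List.inj_on_of_nodup_map hw.1 hl.1 hm.1 (Prod.ext (hl.2.trans hm.2.symm) hlm)

/-- The set of faces. -/
def faces (w : Code) : Finset (Finset Dart) := (darts w).image (orbit w (turnLeft w))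

/-- The face on the left of a directed edge. -/
def face (w : Code) (l : w.toFinset) (b : Bool) : faces w :=
  ⟨orbit w (turnLeft w) (l.1, b), Finset.mem_image_of_mem _
    (mem_darts.2 (List.mem_toFinset.1 l.2))⟩

/-- The next passage. -/
def nextPerm (hw : Valid w) : Equiv.Perm w.toFinset where
  toFun l := ⟨next w l, List.mem_toFinset.2 (next_mem (List.mem_toFinset.1 l.2))⟩
  invFun l := ⟨prev w l, List.mem_toFinset.2 (prev_mem (List.mem_toFinset.1 l.2))⟩
  left_inv l := Subtype.ext (prev_next hw.nodup (List.mem_toFinset.1 l.2))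
  right_inv l := Subtype.ext (next_prev hw.nodup (List.mem_toFinset.1 l.2))

/-- The other passage through the same crossing. -/
def partnerPerm (hw : Valid w) : Equiv.Perm w.toFinset where
  toFun l := ⟨l.1.partner, List.mem_toFinset.2 (hw.2 _ (List.mem_toFinset.1 l.2))⟩
  invFun l := ⟨l.1.partner, List.mem_toFinset.2 (hw.2 _ (List.mem_toFinset.1 l.2))⟩
  left_inv l := Subtype.ext l.1.partner_partner
  right_inv l := Subtype.ext l.1.partner_partner

@[simp] theorem partnerPerm_partnerPerm (hw : Valid w) (l : w.toFinset) :
    partnerPerm hw (partnerPerm hw l) = l := (partnerPerm hw).left_inv l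

theorem face_true_of_left (hw : Valid w) {l : w.toFinset} (h : l.1.left = true) :
    face w l true = face w (nextPerm hw (partnerPerm hw l)) true := by
  refine Subtype.ext ((orbit_turnLeft hw (d := (l.1, true))
      (List.mem_toFinset.1 l.2)).symm.trans ?_)
  rw [turnLeft, if_pos h]
  rfl

theorem face_true_of_right (hw : Valid w) {l : w.toFinset} (h : l.1.left = false) :
    face w l true = face w ((nextPerm hw).symm (partnerPerm hw l)) false := by
  refine Subtype.ext ((orbit_turnLeft hw (d := (l.1, true))
      (List.mem_toFinset.1 l.2)).symm.trans ?_)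
  rw [turnLeft, if_neg (by simp [h])]
  rfl

theorem face_false_of_left (hw : Valid w) {l : w.toFinset} (h : l.1.left = true) :
    face w l false = face w ((nextPerm hw).symm (partnerPerm hw l)) false := by
  refine Subtype.ext ((orbit_turnLeft hw (d := (l.1, false))
      (List.mem_toFinset.1 l.2)).symm.trans ?_)
  rw [turnLeft, if_neg (by simp [h])]
  rfl

theorem face_false_of_right (hw : Valid w) {l : w.toFinset} (h : l.1.left = false) :
    face w l false = face w (nextPerm hw (partnerPerm hw l)) true := by
  refine Subtype.ext ((orbit_turnLeft hw (d := (l.1, false))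
      (List.mem_toFinset.1 l.2)).symm.trans ?_)
  rw [turnLeft, if_pos h]
  rfl

/-- The difference of a function on the faces across the edges. -/
def faceDifference (hw : Valid w) : (faces w → ℚ) →ₗ[ℚ] (w.toFinset → ℚ) where
  toFun g l := g (face w l true) - g (face w ((nextPerm hw).symm l) false)
  map_add' g g' := by
    ext l
    simp only [Pi.add_apply]
    ring
  map_smul' r g := by
    ext l
    simp only [Pi.smul_apply, smul_eq_mul, RingHom.id_apply]
    ring

/-- The crossing of a passage. -/
def crossingOf (l : w.toFinset) : crossings w :=
  ⟨l.1.crossing, by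
    rw [crossings, List.mem_toFinset]
    exact List.mem_map_of_mem (List.mem_toFinset.1 l.2)⟩

/-- The difference of a function on the crossings along the edges. -/
def crossingDifference (hw : Valid w) : (crossings w → ℚ) →ₗ[ℚ] (w.toFinset → ℚ) where
  toFun y l := y (crossingOf l) - y (crossingOf ((nextPerm hw).symm l))
  map_add' g g' := by
    ext l
    simp only [Pi.add_apply]
    ring
  map_smul' r g := by
    ext l
    simp only [Pi.smul_apply, smul_eq_mul, RingHom.id_apply]
    ring

theorem crossingOf_partnerPerm (hw : Valid w) (l : w.toFinset) :
    crossingOf (partnerPerm hw l) = crossingOf l := rfl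

theorem eq_of_nextPerm (hw : Valid w) {h : w.toFinset → ℚ} (hh : ∀ l, h (nextPerm hw l) = h l)
    (l m : w.toFinset) : h m = h l := by
  obtain ⟨m, hm⟩ := m
  obtain ⟨l, hl⟩ := l
  have := forall_of_next hw.nodup (P := fun m => ∀ hm, h ⟨m, hm⟩ = h ⟨l, hl⟩) (l := l)
    (List.mem_toFinset.1 hl) (fun _ => rfl) fun m hm ih hm' =>
      (hh ⟨m, List.mem_toFinset.2 hm⟩).trans (ih _)
  exact this m (List.mem_toFinset.1 hm) hm

theorem finrank_le_one_of_const {ι : Type*} [Fintype ι] {S : Submodule ℚ (ι → ℚ)}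
    (h : ∀ g ∈ S, ∀ i j, g i = g j) : Module.finrank ℚ S ≤ 1 := by
  refine (Submodule.finrank_mono (t := ℚ ∙ (1 : ι → ℚ)) fun g hg => ?_).trans
    ((finrank_span_le_card _).trans (by simp))
  rw [Submodule.mem_span_singleton]
  rcases isEmpty_or_nonempty ι with hι | ⟨⟨i⟩⟩
  · exact ⟨0, by ext i; exact hι.elim i⟩
  · exact ⟨g i, by ext j; simp [h g hg j i]⟩

theorem card_faces_le_finrank (hw : Valid w) :
    (faces w).card ≤ Module.finrank ℚ (LinearMap.range (faceDifference hw)) + 1 := by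
  have h := LinearMap.finrank_range_add_finrank_ker (faceDifference hw)
  rw [Module.finrank_fintype_fun_eq_card, Fintype.card_coe] at h
  have : Module.finrank ℚ (LinearMap.ker (faceDifference hw)) ≤ 1 := by
    refine finrank_le_one_of_const fun g hg => ?_
    have he : ∀ l, g (face w l true) = g (face w ((nextPerm hw).symm l) false) := fun l =>
      sub_eq_zero.1 (congrFun (LinearMap.mem_ker.1 hg) l)
    have he' : ∀ l, g (face w (nextPerm hw l) true) = g (face w l false) := fun l => by
      rw [he, Equiv.symm_apply_apply]
    have hn : ∀ l, g (face w (nextPerm hw l) true) = g (face w l true) := by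
      intro l
      rcases hl : l.1.left with _ | _
      · have hp : (partnerPerm hw l).1.left = true := by simp [partnerPerm, Passage.partner, hl]
        rw [face_true_of_right hw hl, ← he, face_true_of_left hw hp, partnerPerm_partnerPerm]
      · have hp : (partnerPerm hw l).1.left = false := by simp [partnerPerm, Passage.partner, hl]
        have h₁ := congrArg g (face_false_of_right hw hp)
        rw [partnerPerm_partnerPerm] at h₁
        rw [← h₁, ← he', face_true_of_left hw hl]
    have hc := eq_of_nextPerm hw (h := fun l => g (face w l true)) hn
    have hall : ∀ (O : faces w) (l : w.toFinset), g O = g (face w l true) := by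
      intro O l
      obtain ⟨O, hO⟩ := O
      obtain ⟨⟨m, b⟩, hd, rfl⟩ := Finset.mem_image.1 hO
      rw [mem_darts] at hd
      cases b
      · exact (he' ⟨m, List.mem_toFinset.2 hd⟩).symm.trans (hc _ _)
      · exact hc l ⟨m, List.mem_toFinset.2 hd⟩
    intro O O'
    obtain ⟨⟨m, b⟩, hd, -⟩ := Finset.mem_image.1 O.2
    rw [mem_darts] at hd
    rw [hall O ⟨m, List.mem_toFinset.2 hd⟩, hall O' ⟨m, List.mem_toFinset.2 hd⟩]
  omega

theorem card_crossings_le_finrank (hw : Valid w) :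
    (crossings w).card ≤ Module.finrank ℚ (LinearMap.range (crossingDifference hw)) + 1 := by
  have h := LinearMap.finrank_range_add_finrank_ker (crossingDifference hw)
  rw [Module.finrank_fintype_fun_eq_card, Fintype.card_coe] at h
  have : Module.finrank ℚ (LinearMap.ker (crossingDifference hw)) ≤ 1 := by
    refine finrank_le_one_of_const fun y hy => ?_
    have he : ∀ l, y (crossingOf (nextPerm hw l)) = y (crossingOf l) := fun l => by
      have := sub_eq_zero.1 (congrFun (LinearMap.mem_ker.1 hy) (nextPerm hw l))
      rwa [Equiv.symm_apply_apply] at this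
    have hc := eq_of_nextPerm hw (h := fun l => y (crossingOf l)) he
    have hs : ∀ k : crossings w, ∃ l : w.toFinset, crossingOf l = k := by
      rintro ⟨k, hk⟩
      rw [crossings, List.mem_toFinset, List.mem_map] at hk
      obtain ⟨l, hl, rfl⟩ := hk
      exact ⟨⟨l, List.mem_toFinset.2 hl⟩, rfl⟩
    intro i j
    obtain ⟨l, rfl⟩ := hs i
    obtain ⟨m, rfl⟩ := hs j
    exact hc _ _
  omega

theorem sum_crossingDifference (hw : Valid w) (y : crossings w → ℚ) :
    ∑ l, crossingDifference hw y l = 0 := by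
  simp only [crossingDifference, LinearMap.coe_mk, AddHom.coe_mk, Finset.sum_sub_distrib]
  rw [Equiv.sum_comp (nextPerm hw).symm fun l => y (crossingOf l), sub_self]

theorem faceDifference_partnerPerm (hw : Valid w) (g : faces w → ℚ) (l : w.toFinset) :
    faceDifference hw g l + faceDifference hw g (partnerPerm hw l) =
      faceDifference hw g (nextPerm hw l) +
        faceDifference hw g (nextPerm hw (partnerPerm hw l)) := by
  simp only [faceDifference, LinearMap.coe_mk, AddHom.coe_mk, Equiv.symm_apply_apply]
  have key : ∀ l : w.toFinset, l.1.left = true →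
      g (face w l true) - g (face w ((nextPerm hw).symm l) false) +
        (g (face w (partnerPerm hw l) true) -
          g (face w ((nextPerm hw).symm (partnerPerm hw l)) false)) =
      g (face w (nextPerm hw l) true) - g (face w l false) +
        (g (face w (nextPerm hw (partnerPerm hw l)) true) -
          g (face w (partnerPerm hw l) false)) := by
    intro l hl
    have hp : (partnerPerm hw l).1.left = false := by simp [partnerPerm, Passage.partner, hl]
    have h₁ := face_true_of_left hw hl
    have h₂ := face_false_of_left hw hl
    have h₃ := face_true_of_right hw hp
    have h₄ := face_false_of_right hw hp
    rw [partnerPerm_partnerPerm] at h₃ h₄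
    rw [h₁, h₂, h₃, h₄]
    ring
  rcases hl : l.1.left with _ | _
  · have hp : (partnerPerm hw l).1.left = true := by simp [partnerPerm, Passage.partner, hl]
    have := key _ hp
    rw [partnerPerm_partnerPerm] at this
    linarith
  · exact key l hl

theorem sum_crossingDifference_mul_faceDifference (hw : Valid w) (y : crossings w → ℚ)
    (g : faces w → ℚ) : ∑ l, crossingDifference hw y l * faceDifference hw g l = 0 := by
  have h₁ : ∑ l, crossingDifference hw y l * faceDifference hw g l =
      ∑ l, y (crossingOf l) * (faceDifference hw g l - faceDifference hw g (nextPerm hw l)) := by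
    have : ∀ l, crossingDifference hw y l * faceDifference hw g l =
        y (crossingOf l) * faceDifference hw g l -
        y (crossingOf ((nextPerm hw).symm l)) * faceDifference hw g l := fun l => by
      simp only [crossingDifference, LinearMap.coe_mk, AddHom.coe_mk]
      ring
    simp only [this, mul_sub, Finset.sum_sub_distrib]
    congr 1
    rw [← Equiv.sum_comp (nextPerm hw)]
    simp only [Equiv.symm_apply_apply]
  have h₂ := Equiv.sum_comp (partnerPerm hw) fun l =>
    y (crossingOf l) * (faceDifference hw g l - faceDifference hw g (nextPerm hw l))
  have h₃ : ∑ l, (y (crossingOf l) *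
        (faceDifference hw g l - faceDifference hw g (nextPerm hw l)) +
      y (crossingOf (partnerPerm hw l)) * (faceDifference hw g (partnerPerm hw l) -
        faceDifference hw g (nextPerm hw (partnerPerm hw l)))) = 0 := by
    refine Finset.sum_eq_zero fun l _ => ?_
    have := faceDifference_partnerPerm hw g l
    rw [crossingOf_partnerPerm, ← mul_add]
    exact mul_eq_zero_of_right _ (by linarith)
  rw [Finset.sum_add_distrib, h₂] at h₃
  rw [h₁]
  linarith

/-- On a sphere the edges, all with coefficient one, are the coboundary of a function on the
faces. -/
theorem exists_faceDifference_eq_one (hw : Valid w) (hne : w ≠ []) (hg : HasGenus w 0) :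
    ∃ g, faceDifference hw g = 1 := by
  set U := LinearMap.range (faceDifference hw) with hU
  set V := LinearMap.range (crossingDifference hw) with hV
  have horth : ∀ u ∈ U, ∀ v ∈ V, ∑ l, v l * u l = 0 := by
    rintro _ ⟨g, rfl⟩ _ ⟨y, rfl⟩
    exact sum_crossingDifference_mul_faceDifference hw y g
  have hzero : ∀ v : w.toFinset → ℚ, ∑ l, v l * v l = 0 → v = 0 := by
    intro v hv
    ext l
    exact mul_self_eq_zero.1
      ((Finset.sum_eq_zero_iff_of_nonneg fun l _ => mul_self_nonneg (v l)).1 hv l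
        (Finset.mem_univ _))
  have hinf : U ⊓ V = ⊥ := by
    rw [eq_bot_iff]
    rintro v ⟨hu, hv⟩
    exact hzero v (horth v hu v hv)
  have hdim := Submodule.finrank_sup_add_finrank_inf_eq U V
  rw [hinf, finrank_bot, add_zero] at hdim
  have hfaces : _ ≤ Module.finrank ℚ U + 1 := card_faces_le_finrank hw
  have hcross : _ ≤ Module.finrank ℚ V + 1 := card_crossings_le_finrank hw
  have hlen := length_le_two_mul_card_crossings hw
  have hgen : 2 * (faces w).card = w.length + 4 := by
    have := hg
    rwa [HasGenus, numFaces, if_neg hne, mul_zero, add_zero] at this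
  have hX : Module.finrank ℚ (w.toFinset → ℚ) = w.length := by
    rw [Module.finrank_fintype_fun_eq_card, Fintype.card_coe, List.toFinset_card_of_nodup hw.nodup]
  have hle := Submodule.finrank_le (U ⊔ V)
  have htop : U ⊔ V = ⊤ := Submodule.eq_top_of_finrank_eq (by omega)
  have hone : (1 : w.toFinset → ℚ) ∈ U ⊔ V := htop ▸ Submodule.mem_top
  obtain ⟨u, hu, v, hv, huv⟩ := Submodule.mem_sup.1 hone
  have hv0 : v = 0 := by
    apply hzero
    have h₁ : ∑ l, v l * u l + ∑ l, v l * v l = ∑ l, v l := by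
      rw [← Finset.sum_add_distrib]
      refine Finset.sum_congr rfl fun l _ => ?_
      rw [← mul_add, ← Pi.add_apply, huv, Pi.one_apply, mul_one]
    have h₂ : ∑ l, v l = 0 := by
      obtain ⟨y, rfl⟩ := hv
      exact sum_crossingDifference hw y
    rw [horth u hu v hv, h₂, zero_add] at h₁
    exact h₁
  rw [hv0, add_zero] at huv
  obtain ⟨g, rfl⟩ := hu
  exact ⟨g, huv⟩

/-- The label on the left of an edge changes by one at each passage, according to the side. -/
theorem exists_alexander_numbering (hw : Valid w) (hg : HasGenus w 0) :
    ∃ a : Passage → ℤ, ∀ l ∈ w, a (next w l) = a l - sideSign l.left ∧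
      a l.partner = a l - sideSign l.left := by
  rcases eq_or_ne w [] with rfl | hne
  · exact ⟨0, by simp⟩
  obtain ⟨g, hg⟩ := exists_faceDifference_eq_one hw hne hg
  have he : ∀ l, g (face w ((nextPerm hw).symm l) false) = g (face w l true) - 1 := fun l => by
    have : g (face w l true) - g (face w ((nextPerm hw).symm l) false) = 1 := congrFun hg l
    linarith
  have he' : ∀ l, g (face w l false) = g (face w (nextPerm hw l) true) - 1 := fun l => by
    rw [← he, Equiv.symm_apply_apply]
  have key : ∀ l : w.toFinset, l.1.left = true →
      g (face w (nextPerm hw l) true) = g (face w l true) - 1 ∧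
      g (face w (partnerPerm hw l) true) = g (face w l true) - 1 ∧
      g (face w (nextPerm hw (partnerPerm hw l)) true) = g (face w l true) := by
    intro l hl
    have hp : (partnerPerm hw l).1.left = false := by simp [partnerPerm, Passage.partner, hl]
    have h₁ := congrArg g (face_true_of_left hw hl)
    have h₃ := congrArg g (face_true_of_right hw hp)
    have h₄ := congrArg g (face_false_of_right hw hp)
    rw [partnerPerm_partnerPerm] at h₃ h₄
    rw [he] at h₃
    rw [he'] at h₄
    refine ⟨by linarith, by linarith, by linarith⟩
  let a : Passage → ℤ := fun l =>
    if hl : l ∈ w.toFinset then ⌊g (face w ⟨l, hl⟩ true)⌋ else 0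
  have ha : ∀ l : w.toFinset, a l.1 = ⌊g (face w l true)⌋ := fun l => dif_pos l.2
  have main : ∀ l : w.toFinset, a (nextPerm hw l).1 = a l.1 - sideSign l.1.left ∧
      a (partnerPerm hw l).1 = a l.1 - sideSign l.1.left := by
    intro l
    rw [ha, ha, ha]
    rcases hl : l.1.left with _ | _
    · have hp : (partnerPerm hw l).1.left = true := by simp [partnerPerm, Passage.partner, hl]
      obtain ⟨h₁, h₂, h₃⟩ := key _ hp
      rw [partnerPerm_partnerPerm] at h₂ h₃
      rw [h₂, h₃, Int.floor_sub_one]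
      simp [sideSign]
    · obtain ⟨h₁, h₂, h₃⟩ := key _ hl
      rw [h₁, h₂, Int.floor_sub_one]
      simp [sideSign]
  exact ⟨a, fun l hl => main ⟨l, List.mem_toFinset.2 hl⟩⟩

end Alexander

/-! ### The degree of the state sum -/

/-- The Laurent polynomials whose exponents have absolute value at most `n`. -/
noncomputable def bounded (n : ℕ) : AddSubgroup StateRing :=
  AddSubgroup.closure {p | ∃ (c : ZMod 11) (m : ℤ), m.natAbs ≤ n ∧ p = scalar c * tpow m}

theorem scalar_mul_tpow_mem_bounded {n : ℕ} (c : ZMod 11) {m : ℤ} (h : m.natAbs ≤ n) :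
    scalar c * tpow m ∈ bounded n := AddSubgroup.subset_closure ⟨c, m, h, rfl⟩

theorem scalar_mem_bounded (c : ZMod 11) (n : ℕ) : scalar c ∈ bounded n := by
  simpa using scalar_mul_tpow_mem_bounded (n := n) c (m := 0) (by simp)

theorem one_mem_bounded (n : ℕ) : 1 ∈ bounded n := by
  simpa using scalar_mem_bounded 1 n

theorem mul_mem_bounded {m n : ℕ} {p q : StateRing} (hp : p ∈ bounded m) (hq : q ∈ bounded n) :
    p * q ∈ bounded (m + n) := by
  refine AddSubgroup.closure_induction (p := fun p _ => p * q ∈ bounded (m + n)) ?_ (by simp)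
    (fun x y _ _ hx hy => by rw [add_mul]; exact add_mem hx hy)
    (fun x _ hx => by rw [neg_mul]; exact neg_mem hx) hp
  rintro _ ⟨c, k, hk, rfl⟩
  refine AddSubgroup.closure_induction
    (p := fun q _ => scalar c * tpow k * q ∈ bounded (m + n)) ?_ (by simp)
    (fun x y _ _ hx hy => by rw [mul_add]; exact add_mem hx hy)
    (fun x _ hx => by rw [mul_neg]; exact neg_mem hx) hq
  rintro _ ⟨d, l, hl, rfl⟩
  rw [mul_mul_mul_comm, ← map_mul, ← tpow_add]
  exact scalar_mul_tpow_mem_bounded _ (by omega)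

/-- The diagonal matrix of the powers of the variable with the charges as exponents. -/
noncomputable def chargeMatrix (n : ℤ) : Matrix Colour Colour StateRing :=
  Matrix.diagonal fun c => tpow (n * charge c)

theorem chargeMatrix_add (m n : ℤ) :
    chargeMatrix (m + n) = chargeMatrix m * chargeMatrix n := by
  simp only [chargeMatrix, Matrix.diagonal_mul_diagonal, ← tpow_add, add_mul]

theorem chargeMatrix_zero : chargeMatrix 0 = 1 := by
  simp [chargeMatrix]

theorem chargeMatrix_mul_single (m n : ℤ) (i o : Colour) :
    chargeMatrix m * Matrix.single i o 1 =
      tpow (m * charge i - n * charge o) • Matrix.single i o 1 * chargeMatrix n := by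
  rw [chargeMatrix, chargeMatrix, Matrix.smul_mul]
  ext c d
  rw [Matrix.diagonal_mul, Matrix.smul_apply, Matrix.mul_diagonal, Matrix.single_apply]
  split_ifs with h
  · rw [← h.1, ← h.2, smul_eq_mul, mul_one, one_mul, ← tpow_add, sub_add_cancel]
  · simp

/-- The matrix of a passage, relative to an Alexander numbering. -/
noncomputable def gaugedMatrix (f : ℕ → CrossingState) (l : Passage) :
    Matrix Colour Colour StateRing :=
  if l.pass = .virt then chargeMatrix (-sideSign l.left) else passageMatrix f l

/-- The labels of the passages of `u` are `a`, if the first edge has the label `s` and the last one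
the label `e`. -/
def Levels (a : Passage → ℤ) : ℤ → Code → ℤ → Prop
  | s, [], e => s = e
  | s, l :: u, e => a l = s ∧ Levels a (s - sideSign l.left) u e

/-- The exponent by which the gauge transformation changes a passage. -/
def gaugeExponent (a : Passage → ℤ) (f : ℕ → CrossingState) (l : Passage) : ℤ :=
  a l * charge (f l.crossing l.left).1 - (a l - sideSign l.left) * charge (f l.crossing l.left).2

theorem chargeMatrix_mul_prod (a : Passage → ℤ) (f : ℕ → CrossingState) (u : Code) (s e : ℤ)
    (h : Levels a s u e) :
    chargeMatrix s * (u.map (gaugedMatrix f)).prod =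
      ((gaussCode u).map fun l => tpow (gaugeExponent a f l)).prod •
        ((gaussCode u).map (passageMatrix f)).prod * chargeMatrix e := by
  induction u generalizing s with
  | nil =>
    simp only [Levels] at h
    simp [gaussCode, h]
  | cons l u ih =>
    obtain ⟨rfl, h⟩ := h
    rw [List.map_cons, List.prod_cons, ← mul_assoc]
    by_cases hl : l.pass = .virt
    · rw [gaussCode_cons_virt hl, gaugedMatrix, if_pos hl, ← chargeMatrix_add, ← sub_eq_add_neg,
        ih _ h]
    · rw [gaussCode_cons hl, gaugedMatrix, if_neg hl, passageMatrix,
        chargeMatrix_mul_single _ (a l - sideSign l.left), mul_assoc, ih _ h]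
      simp only [List.map_cons, List.prod_cons, gaugeExponent, passageMatrix, Matrix.smul_mul,
        Matrix.mul_smul, smul_smul, mul_assoc]
      rw [mul_comm (List.prod _) (tpow _)]

theorem levels_of_next {w : Code} (hw : w.Nodup) (hne : 0 < w.length) {a : Passage → ℤ}
    (h : ∀ l ∈ w, a (next w l) = a l - sideSign l.left) : Levels a (a w[0]) w (a w[0]) := by
  have key : ∀ j k, k + j = w.length →
      Levels a (a (w[k % w.length]'(Nat.mod_lt _ hne))) (w.drop k) (a w[0]) := by
    intro j
    induction j with
    | zero =>
      rintro k rfl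
      simp [Levels]
    | succ j ih =>
      intro k hk
      have hlt : k < w.length := by omega
      have e : k % w.length = k := Nat.mod_eq_of_lt hlt
      rw [List.drop_eq_getElem_cons hlt]
      simp only [e]
      refine ⟨rfl, ?_⟩
      have := h _ (List.getElem_mem hlt)
      rw [next_getElem hw] at this
      rw [← this]
      exact ih (k + 1) (by omega)
  simpa using key w.length 0 (by simp)

theorem prod_mem_bounded {n : ℕ} (f : Passage → Matrix Colour Colour StateRing)
    (p : Passage → Bool) (u : Code)
    (h : ∀ l ∈ u, ∀ i j, f l i j ∈ bounded (if p l then n else 0)) (i j : Colour) :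
    (u.map f).prod i j ∈ bounded (n * u.countP p) := by
  induction u generalizing i j with
  | nil =>
    rw [List.map_nil, List.prod_nil, Matrix.one_apply]
    split_ifs
    · exact one_mem_bounded _
    · exact zero_mem _
  | cons l u ih =>
    rw [List.map_cons, List.prod_cons, Matrix.mul_apply]
    refine sum_mem fun k _ => ?_
    have := mul_mem_bounded (h l (by simp) i k)
      (ih (fun m hm => h m (List.mem_cons_of_mem _ hm)) k j)
    convert this using 2
    rw [List.countP_cons]
    split_ifs <;> ring

/-- A product over all passages, arranged by crossings. -/
@[to_additive]
theorem prod_map_eq_prod_left {M : Type*} [CommMonoid M] {w : Code} (hw : Valid w)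
    (g : Passage → M) :
    (w.map g).prod = ∏ l ∈ w.toFinset.filter fun l => l.left, g l * g l.partner := by
  rw [← List.prod_toFinset _ hw.nodup, ← Finset.prod_filter_mul_prod_filter_not _ fun l => l.left,
    Finset.prod_mul_distrib]
  congr 1
  refine Finset.prod_nbij' Passage.partner Passage.partner ?_ ?_ (by simp) (by simp) (by simp)
  · intro l hl
    simp only [Finset.mem_filter, List.mem_toFinset] at hl ⊢
    exact ⟨hw.2 _ hl.1, by simpa [Passage.partner] using hl.2⟩
  · intro l hl
    simp only [Finset.mem_filter, List.mem_toFinset] at hl ⊢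
    exact ⟨hw.2 _ hl.1, by simpa [Passage.partner] using hl.2⟩

theorem Valid.gaussCode {w : Code} (hw : Valid w) : Valid (gaussCode w) := by
  refine ⟨nodup_keys_gaussCode hw, fun l hl => ?_⟩
  simp only [VirtualKnot.gaussCode, List.mem_filter, decide_eq_true_eq] at hl ⊢
  exact ⟨hw.2 l hl.1, mt partner_pass_eq_virt.1 hl.2⟩

theorem pass_ne_virt_of_mem_gaussCode {w : Code} {l : Passage} (h : l ∈ gaussCode w) :
    l.pass ≠ .virt := by
  simpa using (List.mem_filter.1 h).2

theorem exists_prod_passageWeight {w : Code} (hw : Valid w) (f : ℕ → CrossingState)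
    {a : Passage → ℤ} (ha : ∀ l ∈ w, a l.partner = a l - sideSign l.left) :
    ∃ c, ((gaussCode w).map (passageWeight f)).prod =
      scalar c * ((gaussCode w).map fun l => tpow (gaugeExponent a f l)).prod := by
  rw [prod_map_eq_prod_left hw.gaussCode, prod_map_eq_prod_left hw.gaussCode]
  refine ⟨∏ l ∈ (gaussCode w).toFinset.filter fun l => l.left,
    bracketWeight l.positive (f l.crossing true) (f l.crossing false), ?_⟩
  rw [map_prod, ← Finset.prod_mul_distrib]
  refine Finset.prod_congr rfl fun l hl => ?_
  simp only [Finset.mem_filter, List.mem_toFinset] at hl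
  have hv := pass_ne_virt_of_mem_gaussCode hl.1
  have hp := ha l (List.mem_filter.1 hl.1).1
  rw [passageWeight_mul_partner f hv, crossingWeight, ← tpow_add]
  refine scalar_mul_tpow_congr fun hb => ?_
  have hc := charge_conservation hb
  have h₁ : l.partner.left = false := by simp [Passage.partner, hl.2]
  have h₂ : l.partner.crossing = l.crossing := rfl
  rw [gaugeExponent, gaugeExponent, hp, h₁, h₂, hl.2]
  simp only [sideSign, if_true, Bool.false_eq_true, if_false]
  linear_combination (1 - a l) * hc

theorem countP_eq_sum {α : Type*} (p : α → Bool) (u : List α) :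
    u.countP p = (u.map fun l => if p l then 1 else 0).sum := by
  induction u with
  | nil => rfl
  | cons l u ih => rw [List.countP_cons, ih, List.map_cons, List.sum_cons, add_comm]

theorem countP_virt {w : Code} (hw : Valid w) :
    w.countP (fun l => decide (l.pass = .virt)) =
      2 * w.countP fun l => decide (l.pass = .virt) && l.left := by
  rw [countP_eq_sum, countP_eq_sum, sum_map_eq_sum_left hw, sum_map_eq_sum_left hw,
    Finset.mul_sum]
  refine Finset.sum_congr rfl fun l hl => ?_
  have h : l.left = true := (Finset.mem_filter.1 hl).2
  have hp : l.partner.left = false := by simp [Passage.partner, h]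
  simp only [partner_pass_eq_virt, h, hp, Bool.and_true, Bool.and_false, Bool.false_eq_true,
    if_false, add_zero]
  ring

/-- The state sum of the Gauss code of a diagram on the sphere has bounded degree. -/
theorem stateSum_mem_bounded (D : Diagram) :
    stateSum (gaussCode D.code) ∈ bounded (2 * D.numVirtual) := by
  refine iterSum_mem _ _ _ _ fun f => ?_
  obtain ⟨a, ha⟩ := exists_alexander_numbering D.valid D.planar
  obtain ⟨c, hc⟩ := exists_prod_passageWeight D.valid f fun l hl => (ha l hl).2
  have htrace : colouringWeight (gaussCode D.code) f =
      scalar c * (D.code.map (gaugedMatrix f)).prod.trace := by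
    rw [colouringWeight, hc, mul_assoc]
    congr 1
    rcases Nat.eq_zero_or_pos D.code.length with h0 | hpos
    · rw [List.length_eq_zero_iff.1 h0]
      simp [gaussCode]
    · have h := chargeMatrix_mul_prod a f D.code _ _
        (levels_of_next D.valid.nodup hpos fun l hl => (ha l hl).1)
      have h' := congrArg (fun X => (X * chargeMatrix (-a D.code[0])).trace) h
      rw [mul_assoc, mul_assoc, ← chargeMatrix_add, add_neg_cancel, chargeMatrix_zero, mul_one,
        Matrix.trace_smul, Matrix.trace_mul_comm, mul_assoc, ← chargeMatrix_add, neg_add_cancel,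
        chargeMatrix_zero, mul_one] at h'
      exact h'.symm
  rw [htrace, ← zero_add (2 * _)]
  refine mul_mem_bounded (scalar_mem_bounded _ _) (sum_mem fun i _ => ?_)
  rw [Diagram.numVirtual, ← countP_virt D.valid, ← one_mul (List.countP _ _)]
  refine prod_mem_bounded _ _ _ (fun l _ i j => ?_) i i
  rw [gaugedMatrix]
  by_cases hl : l.pass = .virt
  · rw [if_pos hl, if_pos (by simpa using hl), chargeMatrix, Matrix.diagonal_apply]
    split_ifs
    · rw [← one_mul (tpow _), ← map_one scalar]
      refine scalar_mul_tpow_mem_bounded _ ?_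
      rcases i with ⟨_, _ | _⟩ <;> cases l.left <;> simp [sideSign, charge]
    · exact zero_mem _
  · rw [if_neg hl, if_neg (by simpa using hl), passageMatrix, Matrix.single_apply]
    split_ifs
    · exact one_mem_bounded _
    · exact zero_mem _

/-! ### Coefficients of the state sums of the three knots -/

/-- A coefficient of a Laurent polynomial. -/
noncomputable def coefficient (n : ℤ) : StateRing →+ ZMod 11 where
  toFun p := AddMonoidAlgebra.coeff (R := ZMod 11) (M := ℤ) p n
  map_zero' := rfl
  map_add' _ _ := rfl

theorem coefficient_scalar_mul_tpow (n : ℤ) (c : ZMod 11) (m : ℤ) :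
    coefficient n (scalar c * tpow m) = if m = n then c else 0 := by
  have : scalar c * tpow m = (AddMonoidAlgebra.single m c : LaurentPolynomial (ZMod 11)) :=
    (LaurentPolynomial.single_eq_C_mul_T c m).symm
  rw [this]
  exact Finsupp.single_apply

theorem coefficient_eq_zero_of_mem_bounded {n : ℕ} {m : ℤ} (h : n < m.natAbs) {p : StateRing}
    (hp : p ∈ bounded n) : coefficient m p = 0 := by
  refine AddSubgroup.closure_induction (p := fun p _ => coefficient m p = 0) ?_ (by simp)
    (fun x y _ _ hx hy => by rw [map_add, hx, hy, add_zero])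
    (fun x _ hx => by rw [map_neg, hx, neg_zero]) hp
  rintro _ ⟨c, k, hk, rfl⟩
  rw [coefficient_scalar_mul_tpow, if_neg]
  rintro rfl
  omega

/-- The trace of a product of elementary matrices. -/
theorem trace_prod_pairMatrix {R : Type*} [CommRing R] (p q : Colour × Colour)
    (u : List (Colour × Colour)) :
    ((p :: u ++ [q]).map (pairMatrix R)).prod.trace =
      if List.IsChain (fun p q => p.2 = q.1) (p :: u ++ [q]) ∧ q.2 = p.1 then 1 else 0 := by
  have key : ∀ (u : List (Colour × Colour)) (p : Colour × Colour) (a b : Colour),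
      ((p :: u ++ [q]).map (pairMatrix R)).prod a b =
      if p.1 = a ∧ List.IsChain (fun p q => p.2 = q.1) (p :: u ++ [q]) ∧ q.2 = b then 1 else 0 := by
    have step : ∀ (p : Colour × Colour) (X : Matrix Colour Colour R) (a b : Colour),
        (pairMatrix R p * X) a b = if p.1 = a then X p.2 b else 0 := by
      intro p X a b
      simp [pairMatrix, Matrix.mul_apply, Matrix.single_apply, ite_and, Finset.sum_ite_irrel]
    intro u
    induction u with
    | nil =>
      intro p a b
      simp only [List.nil_append, List.cons_append, List.map_cons, List.map_nil, List.prod_cons,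
          List.prod_nil, mul_one, step]
      simp [pairMatrix, Matrix.single_apply, ite_and, eq_comm]
    | cons r u ih =>
      intro p a b
      rw [List.cons_append, List.map_cons, List.prod_cons, step, ih]
      simp only [List.cons_append, List.isChain_cons_cons, ite_and, eq_comm (a := r.1)]
  simp only [Matrix.trace, Matrix.diag_apply, key]
  simp [ite_and]

theorem mul_ite_zero {R : Type*} [CommRing R] (p : Prop) [Decidable p] (x : R) :
    x * (if p then 1 else 0) = if p then x else 0 := by
  rw [mul_ite, mul_one, mul_zero]

/-- An iterated sum over the states of four crossings whose nonzero terms are parametrized. -/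
theorem map_iterSum_four {T R N κ : Type*} [Fintype T] [CommRing R] [AddCommMonoid N] [Fintype κ]
    (φ : R →+ N) (t : T) {ks : List ℕ} (hks : ks.Perm [4, 3, 2, 1]) (F : (ℕ → T) → R)
    (j : κ → T × T × T × T) (i : T × T × T × T → κ) (hij : ∀ e, i (j e) = e)
    (hji : ∀ f, F f ≠ 0 → j (i (f 1, f 2, f 3, f 4)) = (f 1, f 2, f 3, f 4)) (H : κ → N)
    (hH : ∀ e f, (f 1, f 2, f 3, f 4) = j e → φ (F f) = H e) :
    φ (iterSum t ks F) = ∑ e, H e := by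
  rw [iterSum_perm t hks]
  simp only [iterSum]
  set g : T × T × T × T → ℕ → T := fun v => Function.update (Function.update (Function.update
    (Function.update (fun _ => t) 1 v.1) 2 v.2.1) 3 v.2.2.1) 4 v.2.2.2
  have hg : ∀ v, (g v 1, g v 2, g v 3, g v 4) = v := fun v => by simp [g]
  trans φ (∑ v, F (g v))
  · simp only [Fintype.sum_prod_type]
    rfl
  rw [map_sum]
  symm
  refine Finset.sum_of_injOn j (fun a _ b _ h => ?_) (by simp) (fun v _ hv => ?_)
    fun e _ => (hH e _ (hg _)).symm
  · rw [← hij a, h, hij]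
  · by_contra hF
    have := hji (g v) fun h => hF (by rw [h, map_zero])
    rw [hg] at this
    exact hv ⟨i v, by simp, this⟩

theorem coefficient_four (n m₁ m₂ m₃ m₄ : ℤ) (c₁ c₂ c₃ c₄ : ZMod 11) :
    coefficient n (scalar c₁ * tpow m₁ * (scalar c₂ * tpow m₂) * (scalar c₃ * tpow m₃) *
      (scalar c₄ * tpow m₄)) =
      c₁ * c₂ * c₃ * c₄ * if m₁ + m₂ + m₃ + m₄ = n then 1 else 0 := by
  have : scalar c₁ * tpow m₁ * (scalar c₂ * tpow m₂) * (scalar c₃ * tpow m₃) *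
      (scalar c₄ * tpow m₄) = scalar (c₁ * c₂ * c₃ * c₄) * tpow (m₁ + m₂ + m₃ + m₄) := by
    simp only [map_mul, tpow_add]
    ring
  rw [this, coefficient_scalar_mul_tpow, mul_ite, mul_one, mul_zero]

/-- Multiplication that does not evaluate the second factor if the first is zero. -/
def lazyMul (a b : ZMod 11) : ZMod 11 := if a = 0 then 0 else a * b

theorem lazyMul_eq (a b : ZMod 11) : lazyMul a b = a * b := by
  rw [lazyMul]
  split_ifs with h
  · rw [h, zero_mul]
  · rfl

theorem colouringWeight_knot422 (f : ℕ → CrossingState) :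
    colouringWeight (gaussCode knot422.code) f =
      if (f 1 false).2 = (f 2 false).1 ∧
        (f 2 false).2 = (f 1 true).1 ∧
        (f 1 true).2 = (f 3 true).1 ∧
        (f 3 true).2 = (f 4 true).1 ∧
        (f 4 true).2 = (f 2 true).1 ∧
        (f 2 true).2 = (f 3 false).1 ∧
        (f 3 false).2 = (f 4 false).1 ∧
        (f 4 false).2 = (f 1 false).1 then
        crossingWeight false (f 1) * crossingWeight false (f 2) * crossingWeight true (f 3) *
            crossingWeight true (f 4)
      else 0 := by
  have hcode : gaussCode knot422.code =
    [⟨1, false, .over⟩, ⟨2, false, .over⟩, ⟨1, true, .under⟩, ⟨3, true, .over⟩, ⟨4, true, .over⟩,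
        ⟨2, true, .under⟩, ⟨3, false, .under⟩, ⟨4, false, .under⟩] := by decide
  have htrace := trace_prod_pairMatrix (R := StateRing) (f 1 false) (f 4 false)
    [f 2 false, f 1 true, f 3 true, f 4 true, f 2 true, f 3 false]
  simp only [List.cons_append, List.nil_append, List.isChain_cons_cons, List.isChain_singleton,
    and_true, and_assoc] at htrace
  rw [hcode, colouringWeight]
  refine (congrArg₂ (· * ·) ?_ htrace).trans (mul_ite_zero _ _)
  simp [passageWeight, Passage.positive]
  ring

theorem coefficient_stateSum_knot422 :
    coefficient 6 (stateSum (gaussCode knot422.code)) =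
    ∑ e₃, ∑ e₄, ∑ e₁, ∑ e₂,
    lazyMul (bracketWeight false (e₃, e₄) (e₁, e₂)) (
      ∑ e₆, ∑ e₇,
      lazyMul (bracketWeight false (e₆, e₇) (e₂, e₃)) (
        ∑ e₅, ∑ e₈,
        lazyMul (bracketWeight true (e₄, e₅) (e₇, e₈)) (
          lazyMul (bracketWeight true (e₅, e₆) (e₈, e₁)) (
            if (charge e₃ - charge e₂) + (charge e₆ - charge e₃) + (charge e₄ - charge e₈) +
                (charge e₅ - charge e₁) = 6 then 1 else 0)))) := by
  have hnames : leftNames (gaussCode knot422.code) = [1, 3, 4, 2] := by decide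
  simp only [lazyMul_eq]
  rw [stateSum, hnames]
  let j : Colour × Colour × Colour × Colour × Colour × Colour × Colour × Colour →
      CrossingState × CrossingState × CrossingState × CrossingState :=
    fun ⟨e₃, e₄, e₁, e₂, e₆, e₇, e₅, e₈⟩ =>
      ⟨fun b => if b then (e₃, e₄) else (e₁, e₂),
      fun b => if b then (e₆, e₇) else (e₂, e₃),
      fun b => if b then (e₄, e₅) else (e₇, e₈),
      fun b => if b then (e₅, e₆) else (e₈, e₁)⟩
  let i : CrossingState × CrossingState × CrossingState × CrossingState →
      Colour × Colour × Colour × Colour × Colour × Colour × Colour × Colour :=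
    fun ⟨v₁, v₂, v₃, v₄⟩ => ⟨(v₁ true).1, (v₃ true).1, (v₁ false).1, (v₂ false).1, (v₂ true).1,
        (v₃ false).1, (v₄ true).1, (v₄ false).1⟩
  let H : Colour × Colour × Colour × Colour × Colour × Colour × Colour × Colour → ZMod 11 :=
    fun ⟨e₃, e₄, e₁, e₂, e₆, e₇, e₅, e₈⟩ => (bracketWeight false (e₃, e₄) (e₁, e₂)) *
        (bracketWeight false (e₆, e₇) (e₂, e₃)) * (bracketWeight true (e₄, e₅) (e₇, e₈)) *
        (bracketWeight true (e₅, e₆) (e₈, e₁)) *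
      (if (charge e₃ - charge e₂) + (charge e₆ - charge e₃) + (charge e₄ - charge e₈) +
          (charge e₅ - charge e₁) = 6 then 1 else 0)
  have hks : [1, 3, 4, 2].Perm [4, 3, 2, 1] := by decide
  have key := map_iterSum_four (coefficient 6) (fun _ => default) hks
    (colouringWeight (gaussCode knot422.code)) j i ?_ ?_ H ?_
  · refine key.trans ?_
    clear_value j i
    repeat first
      | rw [Finset.mul_sum]
      | refine (Fintype.sum_prod_type _).trans (Finset.sum_congr rfl fun _ _ => ?_)
      | refine Finset.sum_congr rfl fun _ _ => ?_
    simp only [H]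
    ring
  · rintro ⟨e₃, e₄, e₁, e₂, e₆, e₇, e₅, e₈⟩
    rfl
  · intro f hf
    rw [colouringWeight_knot422] at hf
    have hv := (ite_ne_right_iff.1 hf).1
    simp only [j, i, Prod.mk.injEq]
    refine ⟨?_, ?_, ?_, ?_⟩ <;> funext b <;> cases b <;> ext1 <;> simp [hv]
  · rintro ⟨e₃, e₄, e₁, e₂, e₆, e₇, e₅, e₈⟩ f hf
    simp only [j, Prod.mk.injEq] at hf
    obtain ⟨h₁, h₂, h₃, h₄⟩ := hf
    rw [colouringWeight_knot422, if_pos (by simp [h₁, h₂, h₃, h₄])]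
    refine (coefficient_four _ _ _ _ _ _ _ _ _).trans ?_
    simp only [h₁, h₂, h₃, h₄, if_true, Bool.false_eq_true, if_false, H]

theorem coefficient_stateSum_knot422_ne_zero :
    coefficient 6 (stateSum (gaussCode knot422.code)) ≠ 0 := by
  rw [coefficient_stateSum_knot422]
  decide +kernel

theorem colouringWeight_knot447 (f : ℕ → CrossingState) :
    colouringWeight (gaussCode knot447.code) f =
      if (f 1 false).2 = (f 2 false).1 ∧
        (f 2 false).2 = (f 3 false).1 ∧
        (f 3 false).2 = (f 4 true).1 ∧
        (f 4 true).2 = (f 3 true).1 ∧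
        (f 3 true).2 = (f 2 true).1 ∧
        (f 2 true).2 = (f 1 true).1 ∧
        (f 1 true).2 = (f 4 false).1 ∧
        (f 4 false).2 = (f 1 false).1 then
        crossingWeight false (f 1) * crossingWeight true (f 2) * crossingWeight false (f 3) *
            crossingWeight true (f 4)
      else 0 := by
  have hcode : gaussCode knot447.code =
    [⟨1, false, .over⟩, ⟨2, false, .under⟩, ⟨3, false, .over⟩, ⟨4, true, .over⟩, ⟨3, true, .under⟩,
        ⟨2, true, .over⟩, ⟨1, true, .under⟩, ⟨4, false, .under⟩] := by decide
  have htrace := trace_prod_pairMatrix (R := StateRing) (f 1 false) (f 4 false)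
    [f 2 false, f 3 false, f 4 true, f 3 true, f 2 true, f 1 true]
  simp only [List.cons_append, List.nil_append, List.isChain_cons_cons, List.isChain_singleton,
    and_true, and_assoc] at htrace
  rw [hcode, colouringWeight]
  refine (congrArg₂ (· * ·) ?_ htrace).trans (mul_ite_zero _ _)
  simp [passageWeight, Passage.positive]
  ring

theorem coefficient_stateSum_knot447 :
    coefficient 6 (stateSum (gaussCode knot447.code)) =
    ∑ e₅, ∑ e₆, ∑ e₃, ∑ e₄,
    lazyMul (bracketWeight false (e₅, e₆) (e₃, e₄)) (
      ∑ e₇, ∑ e₂,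
      lazyMul (bracketWeight true (e₆, e₇) (e₂, e₃)) (
        ∑ e₈, ∑ e₁,
        lazyMul (bracketWeight false (e₇, e₈) (e₁, e₂)) (
          lazyMul (bracketWeight true (e₄, e₅) (e₈, e₁)) (
            if (charge e₇ - charge e₂) + (charge e₆ - charge e₃) + (charge e₅ - charge e₄) +
                (charge e₄ - charge e₁) = 6 then 1 else 0)))) := by
  have hnames : leftNames (gaussCode knot447.code) = [4, 3, 2, 1] := by decide
  simp only [lazyMul_eq]
  rw [stateSum, hnames]
  let j : Colour × Colour × Colour × Colour × Colour × Colour × Colour × Colour →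
      CrossingState × CrossingState × CrossingState × CrossingState :=
    fun ⟨e₅, e₆, e₃, e₄, e₇, e₂, e₈, e₁⟩ =>
      ⟨fun b => if b then (e₇, e₈) else (e₁, e₂),
      fun b => if b then (e₆, e₇) else (e₂, e₃),
      fun b => if b then (e₅, e₆) else (e₃, e₄),
      fun b => if b then (e₄, e₅) else (e₈, e₁)⟩
  let i : CrossingState × CrossingState × CrossingState × CrossingState →
      Colour × Colour × Colour × Colour × Colour × Colour × Colour × Colour :=
    fun ⟨v₁, v₂, v₃, v₄⟩ => ⟨(v₃ true).1, (v₂ true).1, (v₃ false).1, (v₄ true).1, (v₁ true).1,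
        (v₂ false).1, (v₄ false).1, (v₁ false).1⟩
  let H : Colour × Colour × Colour × Colour × Colour × Colour × Colour × Colour → ZMod 11 :=
    fun ⟨e₅, e₆, e₃, e₄, e₇, e₂, e₈, e₁⟩ => (bracketWeight false (e₇, e₈) (e₁, e₂)) *
        (bracketWeight true (e₆, e₇) (e₂, e₃)) * (bracketWeight false (e₅, e₆) (e₃, e₄)) *
        (bracketWeight true (e₄, e₅) (e₈, e₁)) *
      (if (charge e₇ - charge e₂) + (charge e₆ - charge e₃) + (charge e₅ - charge e₄) +
          (charge e₄ - charge e₁) = 6 then 1 else 0)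
  have hks : [4, 3, 2, 1].Perm [4, 3, 2, 1] := by decide
  have key := map_iterSum_four (coefficient 6) (fun _ => default) hks
    (colouringWeight (gaussCode knot447.code)) j i ?_ ?_ H ?_
  · refine key.trans ?_
    clear_value j i
    repeat first
      | rw [Finset.mul_sum]
      | refine (Fintype.sum_prod_type _).trans (Finset.sum_congr rfl fun _ _ => ?_)
      | refine Finset.sum_congr rfl fun _ _ => ?_
    simp only [H]
    ring
  · rintro ⟨e₅, e₆, e₃, e₄, e₇, e₂, e₈, e₁⟩
    rfl
  · intro f hf
    rw [colouringWeight_knot447] at hf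
    have hv := (ite_ne_right_iff.1 hf).1
    simp only [j, i, Prod.mk.injEq]
    refine ⟨?_, ?_, ?_, ?_⟩ <;> funext b <;> cases b <;> ext1 <;> simp [hv]
  · rintro ⟨e₅, e₆, e₃, e₄, e₇, e₂, e₈, e₁⟩ f hf
    simp only [j, Prod.mk.injEq] at hf
    obtain ⟨h₁, h₂, h₃, h₄⟩ := hf
    rw [colouringWeight_knot447, if_pos (by simp [h₁, h₂, h₃, h₄])]
    refine (coefficient_four _ _ _ _ _ _ _ _ _).trans ?_
    simp only [h₁, h₂, h₃, h₄, if_true, Bool.false_eq_true, if_false, H]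

theorem coefficient_stateSum_knot447_ne_zero :
    coefficient 6 (stateSum (gaussCode knot447.code)) ≠ 0 := by
  rw [coefficient_stateSum_knot447]
  decide +kernel

theorem colouringWeight_knot491 (f : ℕ → CrossingState) :
    colouringWeight (gaussCode knot491.code) f =
      if (f 1 false).2 = (f 2 false).1 ∧
        (f 2 false).2 = (f 3 false).1 ∧
        (f 3 false).2 = (f 4 false).1 ∧
        (f 4 false).2 = (f 1 true).1 ∧
        (f 1 true).2 = (f 2 true).1 ∧
        (f 2 true).2 = (f 3 true).1 ∧
        (f 3 true).2 = (f 4 true).1 ∧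
        (f 4 true).2 = (f 1 false).1 then
        crossingWeight false (f 1) * crossingWeight false (f 2) * crossingWeight false (f 3) *
            crossingWeight false (f 4)
      else 0 := by
  have hcode : gaussCode knot491.code =
    [⟨1, false, .over⟩, ⟨2, false, .over⟩, ⟨3, false, .over⟩, ⟨4, false, .over⟩, ⟨1, true, .under⟩,
        ⟨2, true, .under⟩, ⟨3, true, .under⟩, ⟨4, true, .under⟩] := by decide
  have htrace := trace_prod_pairMatrix (R := StateRing) (f 1 false) (f 4 true)
    [f 2 false, f 3 false, f 4 false, f 1 true, f 2 true, f 3 true]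
  simp only [List.cons_append, List.nil_append, List.isChain_cons_cons, List.isChain_singleton,
    and_true, and_assoc] at htrace
  rw [hcode, colouringWeight]
  refine (congrArg₂ (· * ·) ?_ htrace).trans (mul_ite_zero _ _)
  simp [passageWeight, Passage.positive]
  ring

theorem coefficient_stateSum_knot491 :
    coefficient 6 (stateSum (gaussCode knot491.code)) =
    ∑ e₅, ∑ e₆, ∑ e₁, ∑ e₂,
    lazyMul (bracketWeight false (e₅, e₆) (e₁, e₂)) (
      ∑ e₇, ∑ e₃,
      lazyMul (bracketWeight false (e₆, e₇) (e₂, e₃)) (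
        ∑ e₈, ∑ e₄,
        lazyMul (bracketWeight false (e₇, e₈) (e₃, e₄)) (
          lazyMul (bracketWeight false (e₈, e₁) (e₄, e₅)) (
            if (charge e₅ - charge e₂) + (charge e₆ - charge e₃) + (charge e₇ - charge e₄) +
                (charge e₈ - charge e₅) = 6 then 1 else 0)))) := by
  have hnames : leftNames (gaussCode knot491.code) = [1, 2, 3, 4] := by decide
  simp only [lazyMul_eq]
  rw [stateSum, hnames]
  let j : Colour × Colour × Colour × Colour × Colour × Colour × Colour × Colour →
      CrossingState × CrossingState × CrossingState × CrossingState :=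
    fun ⟨e₅, e₆, e₁, e₂, e₇, e₃, e₈, e₄⟩ =>
      ⟨fun b => if b then (e₅, e₆) else (e₁, e₂),
      fun b => if b then (e₆, e₇) else (e₂, e₃),
      fun b => if b then (e₇, e₈) else (e₃, e₄),
      fun b => if b then (e₈, e₁) else (e₄, e₅)⟩
  let i : CrossingState × CrossingState × CrossingState × CrossingState →
      Colour × Colour × Colour × Colour × Colour × Colour × Colour × Colour :=
    fun ⟨v₁, v₂, v₃, v₄⟩ => ⟨(v₁ true).1, (v₂ true).1, (v₁ false).1, (v₂ false).1, (v₃ true).1,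
        (v₃ false).1, (v₄ true).1, (v₄ false).1⟩
  let H : Colour × Colour × Colour × Colour × Colour × Colour × Colour × Colour → ZMod 11 :=
    fun ⟨e₅, e₆, e₁, e₂, e₇, e₃, e₈, e₄⟩ => (bracketWeight false (e₅, e₆) (e₁, e₂)) *
        (bracketWeight false (e₆, e₇) (e₂, e₃)) * (bracketWeight false (e₇, e₈) (e₃, e₄)) *
        (bracketWeight false (e₈, e₁) (e₄, e₅)) *
      (if (charge e₅ - charge e₂) + (charge e₆ - charge e₃) + (charge e₇ - charge e₄) +
          (charge e₈ - charge e₅) = 6 then 1 else 0)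
  have hks : [1, 2, 3, 4].Perm [4, 3, 2, 1] := by decide
  have key := map_iterSum_four (coefficient 6) (fun _ => default) hks
    (colouringWeight (gaussCode knot491.code)) j i ?_ ?_ H ?_
  · refine key.trans ?_
    clear_value j i
    repeat first
      | rw [Finset.mul_sum]
      | refine (Fintype.sum_prod_type _).trans (Finset.sum_congr rfl fun _ _ => ?_)
      | refine Finset.sum_congr rfl fun _ _ => ?_
    simp only [H]
    ring
  · rintro ⟨e₅, e₆, e₁, e₂, e₇, e₃, e₈, e₄⟩
    rfl
  · intro f hf
    rw [colouringWeight_knot491] at hf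
    have hv := (ite_ne_right_iff.1 hf).1
    simp only [j, i, Prod.mk.injEq]
    refine ⟨?_, ?_, ?_, ?_⟩ <;> funext b <;> cases b <;> ext1 <;> simp [hv]
  · rintro ⟨e₅, e₆, e₁, e₂, e₇, e₃, e₈, e₄⟩ f hf
    simp only [j, Prod.mk.injEq] at hf
    obtain ⟨h₁, h₂, h₃, h₄⟩ := hf
    rw [colouringWeight_knot491, if_pos (by simp [h₁, h₂, h₃, h₄])]
    refine (coefficient_four _ _ _ _ _ _ _ _ _).trans ?_
    simp only [h₁, h₂, h₃, h₄, if_true, Bool.false_eq_true, if_false, H]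

theorem coefficient_stateSum_knot491_ne_zero :
    coefficient 6 (stateSum (gaussCode knot491.code)) ≠ 0 := by
  rw [coefficient_stateSum_knot491]
  decide +kernel

/-! ### Lower bounds -/

theorem mem_bounded_of_equivalent {D E : Diagram} (h : Equivalent D E) {n : ℕ}
    (hE : stateSum (gaussCode E.code) ∈ bounded n) : stateSum (gaussCode D.code) ∈ bounded n := by
  obtain ⟨c, hc⟩ := h.stateSum_eq
  rw [hc, ← Nat.zero_add n]
  exact mul_mem_bounded (scalar_mem_bounded _ _) hE

theorem three_le_numVirtual {D E : Diagram} (h : Equivalent D E)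
    (hD : coefficient 6 (stateSum (gaussCode D.code)) ≠ 0) : 3 ≤ E.numVirtual := by
  by_contra hE
  refine hD (coefficient_eq_zero_of_mem_bounded (n := 2 * E.numVirtual) (by simp; omega) ?_)
  exact mem_bounded_of_equivalent h (stateSum_mem_bounded E)

theorem not_hasGenus_zero {D E : Diagram} (h : Equivalent D E)
    (hD : coefficient 6 (stateSum (gaussCode D.code)) ≠ 0) :
    ¬HasGenus (gaussCode E.code) 0 := by
  intro hE
  have hmem := stateSum_mem_bounded ⟨gaussCode E.code, E.valid.gaussCode, hE⟩
  have hv : Diagram.numVirtual ⟨gaussCode E.code, E.valid.gaussCode, hE⟩ = 0 := by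
    simp only [Diagram.numVirtual, gaussCode, List.countP_eq_zero, List.mem_filter]
    rintro l ⟨-, hl⟩
    simp_all
  have hg : gaussCode (gaussCode E.code) = gaussCode E.code := by simp [gaussCode]
  rw [hv] at hmem
  simp only [hg] at hmem
  exact hD (coefficient_eq_zero_of_mem_bounded (by simp) (mem_bounded_of_equivalent h hmem))

theorem virtualCrossingNumber_eq_three {D E : Diagram} (h : Equivalent D E)
    (hD : coefficient 6 (stateSum (gaussCode D.code)) ≠ 0) (hE : E.numVirtual = 3) :
    virtualCrossingNumber D = 3 := by
  refine le_antisymm (Nat.sInf_le ⟨E, h, hE⟩) (le_csInf ⟨3, E, h, hE⟩ ?_)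
  rintro n ⟨E', h', rfl⟩
  exact three_le_numVirtual h' hD

theorem minimalGenus_eq_one {D E : Diagram} (h : Equivalent D E)
    (hD : coefficient 6 (stateSum (gaussCode D.code)) ≠ 0) (hE : HasGenus (gaussCode E.code) 1) :
    minimalGenus D = 1 := by
  refine le_antisymm (Nat.sInf_le ⟨E, h, hE⟩) (le_csInf ⟨1, E, h, hE⟩ ?_)
  rintro n ⟨E', h', hn⟩
  rcases Nat.eq_zero_or_pos n with rfl | hn'
  · exact absurd hn (not_hasGenus_zero h' hD)
  · exact hn'

/-- The diagram of the knot 4.22 with another base point. -/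
def knot422Rotated : Diagram where
  code := [⟨3, true, .over⟩, ⟨6, false, .virt⟩, ⟨7, false, .virt⟩, ⟨4, true, .over⟩,
    ⟨5, false, .virt⟩, ⟨2, true, .under⟩, ⟨8, true, .virt⟩, ⟨3, false, .under⟩, ⟨9, false, .virt⟩,
    ⟨7, true, .virt⟩, ⟨4, false, .under⟩, ⟨9, true, .virt⟩, ⟨6, true, .virt⟩, ⟨8, false, .virt⟩,
    ⟨1, false, .over⟩, ⟨5, true, .virt⟩, ⟨2, false, .over⟩, ⟨1, true, .under⟩]
  valid := by decide +kernel
  planar := by decide +kernel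

/-- The diagram of the knot 4.22 after a mixed third move. -/
def knot422Moved : Diagram where
  code := [⟨6, false, .virt⟩, ⟨3, true, .over⟩, ⟨7, false, .virt⟩, ⟨4, true, .over⟩,
    ⟨5, false, .virt⟩, ⟨2, true, .under⟩, ⟨8, true, .virt⟩, ⟨9, false, .virt⟩, ⟨3, false, .under⟩,
    ⟨7, true, .virt⟩, ⟨4, false, .under⟩, ⟨6, true, .virt⟩, ⟨9, true, .virt⟩, ⟨8, false, .virt⟩,
    ⟨1, false, .over⟩, ⟨5, true, .virt⟩, ⟨2, false, .over⟩, ⟨1, true, .under⟩]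
  valid := by decide +kernel
  planar := by decide +kernel

/-- The diagram after the third move with another base point. -/
def knot422MovedRotated : Diagram where
  code := [⟨8, true, .virt⟩, ⟨9, false, .virt⟩, ⟨3, false, .under⟩, ⟨7, true, .virt⟩,
    ⟨4, false, .under⟩, ⟨6, true, .virt⟩, ⟨9, true, .virt⟩, ⟨8, false, .virt⟩, ⟨1, false, .over⟩,
    ⟨5, true, .virt⟩, ⟨2, false, .over⟩, ⟨1, true, .under⟩, ⟨6, false, .virt⟩, ⟨3, true, .over⟩,
    ⟨7, false, .virt⟩, ⟨4, true, .over⟩, ⟨5, false, .virt⟩, ⟨2, true, .under⟩]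
  valid := by decide +kernel
  planar := by decide +kernel

/-- A diagram of the knot 4.22 with three virtual crossings. -/
def knot422Reduced : Diagram where
  code := [⟨3, false, .under⟩, ⟨7, true, .virt⟩, ⟨4, false, .under⟩, ⟨6, true, .virt⟩,
    ⟨1, false, .over⟩, ⟨5, true, .virt⟩, ⟨2, false, .over⟩, ⟨1, true, .under⟩, ⟨6, false, .virt⟩,
    ⟨3, true, .over⟩, ⟨7, false, .virt⟩, ⟨4, true, .over⟩, ⟨5, false, .virt⟩, ⟨2, true, .under⟩]
  valid := by decide +kernel
  planar := by decide +kernel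

theorem knot422_equivalent_reduced : Equivalent knot422 knot422Reduced := by
  refine .trans _ knot422Rotated _ (.rel _ _ ?_) (.trans _ knot422Moved _ (.rel _ _ ?_)
    (.trans _ knot422MovedRotated _ (.rel _ _ ?_) (.rel _ _ ?_)))
  · exact Move.rotate (knot422.code.take 4) (knot422.code.drop 4)
  · exact Move.r3 ⟨3, true, .over⟩ ⟨6, false, .virt⟩ ⟨9, false, .virt⟩
      ((knot422Rotated.code.drop 2).take 5) ((knot422Rotated.code.drop 9).take 2)
      (knot422Rotated.code.drop 13) (.inr (.inr (.inl ⟨rfl, rfl⟩)))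
  · exact Move.rotate (knot422Moved.code.take 6) (knot422Moved.code.drop 6)
  · exact Move.r2' ⟨8, true, .virt⟩ ⟨9, false, .virt⟩ ((knot422MovedRotated.code.drop 2).take 4)
      (knot422MovedRotated.code.drop 8) rfl (by decide)

theorem virtualCrossingNumber_knot422 : virtualCrossingNumber knot422 = 3 :=
  virtualCrossingNumber_eq_three knot422_equivalent_reduced coefficient_stateSum_knot422_ne_zero
    (by decide)

theorem virtualCrossingNumber_knot447 : virtualCrossingNumber knot447 = 3 :=
  virtualCrossingNumber_eq_three (.refl _) coefficient_stateSum_knot447_ne_zero (by decide)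

theorem virtualCrossingNumber_knot491 : virtualCrossingNumber knot491 = 3 :=
  virtualCrossingNumber_eq_three (.refl _) coefficient_stateSum_knot491_ne_zero (by decide)

theorem minimalGenus_knot491 : minimalGenus knot491 = 1 :=
  minimalGenus_eq_one (.refl _) coefficient_stateSum_knot491_ne_zero (by decide +kernel)

/-! ### The arrow polynomials of the three knots -/

theorem A_zero : A 0 = 1 := by simp [A]

theorem A_mul (m n : ℤ) : A m * A n = A (m + n) := by
  rw [A, A, A, ← map_mul, ← LaurentPolynomial.T_add]

theorem K_zero : K 0 = 1 := rfl

/-- The exponent, the number of loops and the indices of the loops of a state. -/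
def stateData (w : Code) (S : Finset ℕ) : ℤ × ℕ × Multiset ℕ :=
  (stateExponent w S, (loops w S).card, (loops w S).val.map (loopIndex S))

/-- The contribution of a state with the given exponent, number of loops and indices. -/
noncomputable def stateValue (x : ℤ × ℕ × Multiset ℕ) : ArrowRing :=
  A x.1 * (-A 2 - A (-2)) ^ (x.2.1 - 1) * (x.2.2.map K).prod

/-- The data of all states. -/
def arrowData (w : Code) : Multiset (ℤ × ℕ × Multiset ℕ) :=
  (crossings w).powerset.val.map (stateData w)

theorem arrowPolynomial_eq {D : Diagram} {w : Code} (hw : gaussCode D.code = w)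
    {s : Multiset (ℤ × ℕ × Multiset ℕ)} (hs : arrowData w = s) :
    arrowPolynomial D = (s.map stateValue).sum := by
  rw [← hs, arrowPolynomial, hw, arrowData, Multiset.map_map]
  simp only [arrowOfGaussCode, Finset.sum, Finset.prod, Function.comp_def, stateValue, stateData,
    Multiset.map_map]

theorem stateValue_one (m : ℤ) (s : Multiset ℕ) :
    stateValue (m, 1, s) = A m * (s.map K).prod := by
  simp [stateValue]

theorem stateValue_succ (m : ℤ) (k : ℕ) (s : Multiset ℕ) :
    stateValue (m, k + 2, s) =
      -stateValue (m + 2, k + 1, s) - stateValue (m - 2, k + 1, s) := by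
  simp only [stateValue, Nat.add_sub_cancel, show k + 2 - 1 = k + 1 from rfl, sub_eq_add_neg m,
    ← A_mul]
  ring

theorem arrowPolynomial_knot422 :
    arrowPolynomial knot422 =
      -A 6 * K 1 + A 2 * K 1 + K 2 + 2 - A 2 * K 1 * K 2 - A (-2) * K 1 * K 2 - K 1 ^ 2
        - A (-4) * K 1 ^ 2 + A 2 * K 1 ^ 3 + 2 * A (-2) * K 1 ^ 3 + A (-6) * K 1 ^ 3
        - A (-2) * K 1 - A (-6) * K 1 := by
  have hcode : gaussCode knot422.code =
    [⟨1, false, .over⟩, ⟨2, false, .over⟩, ⟨1, true, .under⟩, ⟨3, true, .over⟩, ⟨4, true, .over⟩,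
      ⟨2, true, .under⟩, ⟨3, false, .under⟩, ⟨4, false, .under⟩] := by decide
  have hdata : arrowData
      [⟨1, false, .over⟩, ⟨2, false, .over⟩, ⟨1, true, .under⟩, ⟨3, true, .over⟩, ⟨4, true, .over⟩,
        ⟨2, true, .under⟩, ⟨3, false, .under⟩, ⟨4, false, .under⟩] =
    {(0, 1, {0}), (2, 1, {1}), (2, 1, {1}), (4, 2, {1, 0}), (-2, 1, {1}), (0, 2, {1, 0}),
      (0, 1, {0}), (2, 1, {1}), (-2, 1, {1}), (0, 2, {0, 1}), (0, 1, {2}), (2, 1, {1}),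
      (-4, 2, {1, 0}), (-2, 3, {1, 1, 1}), (-2, 2, {1, 1}), (0, 2, {1, 2})} := by
    decide +kernel
  rw [arrowPolynomial_eq hcode hdata]
  simp only [Multiset.insert_eq_cons, Multiset.map_cons, Multiset.map_singleton,
    Multiset.sum_cons, Multiset.sum_singleton, stateValue_succ _ 0, stateValue_succ _ 1,
    stateValue_one, Multiset.prod_cons, Multiset.prod_singleton, zero_add, K_zero]
  norm_num [A_zero]
  ring

theorem arrowPolynomial_knot447 :
    arrowPolynomial knot447 =
      A 2 * K 3 + 1 - A (-2) * K 1 * K 2 - A 2 * K 1 * K 2 + A (-2) * K 1 := by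
  have hcode : gaussCode knot447.code =
    [⟨1, false, .over⟩, ⟨2, false, .under⟩, ⟨3, false, .over⟩, ⟨4, true, .over⟩,
      ⟨3, true, .under⟩, ⟨2, true, .over⟩, ⟨1, true, .under⟩, ⟨4, false, .under⟩] := by decide
  have hdata : arrowData
      [⟨1, false, .over⟩, ⟨2, false, .under⟩, ⟨3, false, .over⟩, ⟨4, true, .over⟩,
        ⟨3, true, .under⟩, ⟨2, true, .over⟩, ⟨1, true, .under⟩, ⟨4, false, .under⟩] =
    {(0, 3, {0, 0, 0}), (2, 2, {0, 0}), (-2, 2, {0, 0}), (0, 1, {0}), (2, 2, {0, 0}), (4, 1, {0}),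
      (0, 1, {0}), (2, 1, {3}), (-2, 3, {0, 0, 1}), (0, 2, {0, 1}), (-4, 2, {0, 1}), (-2, 1, {1}),
      (0, 2, {0, 1}), (2, 1, {1}), (-2, 1, {1}), (0, 2, {1, 2})} := by
    decide +kernel
  rw [arrowPolynomial_eq hcode hdata]
  simp only [Multiset.insert_eq_cons, Multiset.map_cons, Multiset.map_singleton,
    Multiset.sum_cons, Multiset.sum_singleton, stateValue_succ _ 0, stateValue_succ _ 1,
    stateValue_one, Multiset.prod_cons, Multiset.prod_singleton, zero_add, K_zero]
  norm_num [A_zero]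
  ring

theorem arrowPolynomial_knot491 :
    arrowPolynomial knot491 =
      -A 10 * K 1 ^ 3 - A 6 * K 1 ^ 3 + A 2 * K 1 ^ 3 + 2 * A 6 * K 1 + A (-2) * K 1 ^ 3
        - 2 * A 2 * K 1 + A (-4) := by
  have hcode : gaussCode knot491.code =
    [⟨1, false, .over⟩, ⟨2, false, .over⟩, ⟨3, false, .over⟩, ⟨4, false, .over⟩,
      ⟨1, true, .under⟩, ⟨2, true, .under⟩, ⟨3, true, .under⟩, ⟨4, true, .under⟩] := by decide
  have hdata : arrowData
      [⟨1, false, .over⟩, ⟨2, false, .over⟩, ⟨3, false, .over⟩, ⟨4, false, .over⟩,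
        ⟨1, true, .under⟩, ⟨2, true, .under⟩, ⟨3, true, .under⟩, ⟨4, true, .under⟩] =
    {(-4, 1, {0}), (-2, 1, {1}), (-2, 1, {1}), (0, 2, {1, 0}), (-2, 1, {1}), (0, 2, {0, 1}),
      (0, 2, {1, 0}), (2, 3, {1, 1, 1}), (-2, 1, {1}), (0, 2, {1, 0}), (0, 2, {0, 1}),
      (2, 3, {1, 0, 0}), (0, 2, {1, 0}), (2, 3, {0, 1, 0}), (2, 3, {1, 1, 1}),
          (4, 4, {1, 1, 1, 0})} := by
    decide +kernel
  rw [arrowPolynomial_eq hcode hdata]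
  simp only [Multiset.insert_eq_cons, Multiset.map_cons, Multiset.map_singleton,
    Multiset.sum_cons, Multiset.sum_singleton, stateValue_succ _ 0, stateValue_succ _ 1,
    stateValue_succ _ 2, stateValue_one, Multiset.prod_cons, Multiset.prod_singleton, zero_add,
    K_zero]
  norm_num [A_zero]
  ring

/-! ### The maximal degree -/

section Degree

variable {p q : ArrowRing} {m n : ℕ}

theorem maxKDegree_add_le (hp : maxKDegree p ≤ n) (hq : maxKDegree q ≤ n) :
    maxKDegree (p + q) ≤ n := by
  refine Finset.sup_le fun d hd => ?_
  rcases Finset.mem_union.1 (MvPolynomial.support_add hd) with h | h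
  · exact (MvPolynomial.le_weightedTotalDegree id h).trans hp
  · exact (MvPolynomial.le_weightedTotalDegree id h).trans hq

theorem maxKDegree_neg_le (hp : maxKDegree p ≤ n) : maxKDegree (-p) ≤ n := by
  rwa [maxKDegree, MvPolynomial.weightedTotalDegree, MvPolynomial.support_neg]

theorem maxKDegree_sub_le (hp : maxKDegree p ≤ n) (hq : maxKDegree q ≤ n) :
    maxKDegree (p - q) ≤ n :=
  sub_eq_add_neg p q ▸ maxKDegree_add_le hp (maxKDegree_neg_le hq)

theorem maxKDegree_mul_le (hp : maxKDegree p ≤ m) (hq : maxKDegree q ≤ n) :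
    maxKDegree (p * q) ≤ m + n := by
  refine Finset.sup_le fun d hd => ?_
  obtain ⟨a, ha, b, hb, rfl⟩ := Finset.mem_add.1 (MvPolynomial.support_mul p q hd)
  rw [map_add]
  exact add_le_add ((MvPolynomial.le_weightedTotalDegree id ha).trans hp)
    ((MvPolynomial.le_weightedTotalDegree id hb).trans hq)

theorem maxKDegree_C (a : LaurentPolynomial ℤ) : maxKDegree (MvPolynomial.C a) ≤ 0 := by
  refine Finset.sup_le fun d hd => ?_
  rw [MvPolynomial.mem_support_iff, MvPolynomial.coeff_C] at hd
  rw [← (ite_ne_right_iff.1 hd).1, map_zero]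

theorem maxKDegree_A (m : ℤ) : maxKDegree (A m) ≤ 0 := maxKDegree_C _

theorem maxKDegree_one : maxKDegree 1 ≤ 0 := maxKDegree_C 1

theorem maxKDegree_two : maxKDegree 2 ≤ 0 := maxKDegree_C 2

theorem maxKDegree_K (n : ℕ) : maxKDegree (K n) ≤ n := by
  rw [K]
  split_ifs with h
  · exact maxKDegree_one.trans n.zero_le
  · refine Finset.sup_le fun d hd => ?_
    rw [MvPolynomial.mem_support_iff, MvPolynomial.coeff_X] at hd
    rw [← (ite_ne_right_iff.1 hd).1]
    simp [Finsupp.weight_single]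

theorem maxKDegree_pow_le (hp : maxKDegree p ≤ m) (n : ℕ) : maxKDegree (p ^ n) ≤ n * m := by
  induction n with
  | zero => simpa using maxKDegree_one
  | succ n ih =>
    rw [pow_succ, add_mul, one_mul]
    exact maxKDegree_mul_le ih hp

theorem le_maxKDegree {d : ℕ →₀ ℕ} (hd : p.coeff d ≠ 0) : Finsupp.weight id d ≤ maxKDegree p :=
  MvPolynomial.le_weightedTotalDegree id (MvPolynomial.mem_support_iff.2 hd)

end Degree

theorem K_eq_X {n : ℕ} (h : n ≠ 0) : K n = MvPolynomial.X n := if_neg h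

theorem coeff_A_mul (m : ℤ) (p : ArrowRing) (d : ℕ →₀ ℕ) :
    (A m * p).coeff d = LaurentPolynomial.T m * p.coeff d := MvPolynomial.coeff_C_mul ..

theorem coeff_neg_A_mul (m : ℤ) (p : ArrowRing) (d : ℕ →₀ ℕ) :
    (-A m * p).coeff d = -(LaurentPolynomial.T m * p.coeff d) := by
  rw [← coeff_A_mul, ← MvPolynomial.coeff_neg]
  exact congrArg (MvPolynomial.coeff d) (neg_mul (A m) p)

theorem coeff_two_mul (p : ArrowRing) (d : ℕ →₀ ℕ) : (2 * p).coeff d = 2 * p.coeff d := by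
  rw [two_mul, two_mul, MvPolynomial.coeff_add]

theorem coeff_A (m : ℤ) {d : ℕ →₀ ℕ} (h : d ≠ 0) : (A m).coeff d = 0 := by
  rw [A, MvPolynomial.coeff_C, if_neg h.symm]

theorem coeff_K_one_mul_K_two (d : ℕ →₀ ℕ) :
    (K 1 * K 2).coeff d = if Finsupp.single 1 1 + Finsupp.single 2 1 = d then 1 else 0 := by
  rw [← MvPolynomial.coeff_monomial]
  simp [K, MvPolynomial.X, MvPolynomial.monomial_mul]

theorem maxKDegree_knot422 : maxKDegree (arrowPolynomial knot422) = 3 := by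
  rw [arrowPolynomial_knot422]
  apply le_antisymm
  · repeat with_reducible first | apply maxKDegree_add_le | apply maxKDegree_sub_le
    all_goals
      apply le_trans
      · repeat with_reducible first
          | exact maxKDegree_A _
          | exact maxKDegree_K _
          | exact maxKDegree_two
          | apply maxKDegree_neg_le
          | apply maxKDegree_mul_le
          | apply maxKDegree_pow_le
      · norm_num
  · refine le_trans (by simp [Finsupp.weight_single]) (le_maxKDegree (d := Finsupp.single 1 3) ?_)
    have h12 : (Finsupp.single 1 1 + Finsupp.single 2 1 : ℕ →₀ ℕ) ≠ Finsupp.single 1 3 :=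
      fun h => by simpa using DFunLike.congr_fun h 2
    have h2 : (2 : ArrowRing).coeff (Finsupp.single 1 3) = 0 := by
      rw [← mul_one 2, coeff_two_mul, MvPolynomial.coeff_one, if_neg, mul_zero]
      exact (Finsupp.single_ne_zero.2 (by norm_num)).symm
    intro h
    simp only [mul_assoc, MvPolynomial.coeff_add, MvPolynomial.coeff_sub, coeff_neg_A_mul,
        coeff_A_mul,
      coeff_two_mul, coeff_K_one_mul_K_two, h12, h2] at h
    simp [K_eq_X, MvPolynomial.coeff_X, MvPolynomial.coeff_X_pow, Finsupp.single_eq_single_iff] at h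
    simpa [two_mul] using congrArg (fun q : LaurentPolynomial ℤ => q.coeff 2) h

theorem maxKDegree_knot447 : maxKDegree (arrowPolynomial knot447) = 3 := by
  rw [arrowPolynomial_knot447]
  apply le_antisymm
  · repeat with_reducible first | apply maxKDegree_add_le | apply maxKDegree_sub_le
    all_goals
      apply le_trans
      · repeat with_reducible first
          | exact maxKDegree_A _
          | exact maxKDegree_K _
          | exact maxKDegree_one
          | apply maxKDegree_mul_le
      · norm_num
  · refine le_trans (by simp [Finsupp.weight_single]) (le_maxKDegree (d := Finsupp.single 3 1) ?_)
    have h12 : (Finsupp.single 1 1 + Finsupp.single 2 1 : ℕ →₀ ℕ) ≠ Finsupp.single 3 1 :=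
      fun h => by simpa using DFunLike.congr_fun h 2
    have h1 : (1 : ArrowRing).coeff (Finsupp.single 3 1) = 0 := by
      rw [MvPolynomial.coeff_one, if_neg]
      exact (Finsupp.single_ne_zero.2 (by norm_num)).symm
    intro h
    simp only [mul_assoc, MvPolynomial.coeff_add, MvPolynomial.coeff_sub,
      coeff_A_mul, coeff_K_one_mul_K_two, h12, h1] at h
    simp [K_eq_X, MvPolynomial.coeff_X, Finsupp.single_eq_single_iff] at h
    simpa using congrArg (fun q : LaurentPolynomial ℤ => q.coeff 2) h

theorem maxKDegree_knot491 : maxKDegree (arrowPolynomial knot491) = 3 := by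
  rw [arrowPolynomial_knot491]
  apply le_antisymm
  · repeat with_reducible first | apply maxKDegree_add_le | apply maxKDegree_sub_le
    all_goals
      apply le_trans
      · repeat with_reducible first
          | exact maxKDegree_A _
          | exact maxKDegree_K _
          | exact maxKDegree_two
          | apply maxKDegree_neg_le
          | apply maxKDegree_mul_le
          | apply maxKDegree_pow_le
      · norm_num
  · refine le_trans (by simp [Finsupp.weight_single]) (le_maxKDegree (d := Finsupp.single 1 3) ?_)
    have h0 : (Finsupp.single 1 3 : ℕ →₀ ℕ) ≠ 0 := Finsupp.single_ne_zero.2 (by norm_num)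
    intro h
    simp only [mul_assoc, MvPolynomial.coeff_add, MvPolynomial.coeff_sub, coeff_neg_A_mul,
        coeff_A_mul,
      coeff_two_mul, coeff_A _ h0] at h
    simp [K_eq_X, MvPolynomial.coeff_X, MvPolynomial.coeff_X_pow, Finsupp.single_eq_single_iff] at h
    simpa using congrArg (fun q : LaurentPolynomial ℤ => q.coeff 2) h

end VirtualKnot

open VirtualKnot in
theorem mainTheorem3 :
    (virtualCrossingNumber knot422 = 3 ∧
      maxKDegree (arrowPolynomial knot422) = 3 ∧
      arrowPolynomial knot422 =
        -A 6 * K 1 + A 2 * K 1 + K 2 + 2 - A 2 * K 1 * K 2 - A (-2) * K 1 * K 2 - K 1 ^ 2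
          - A (-4) * K 1 ^ 2 + A 2 * K 1 ^ 3 + 2 * A (-2) * K 1 ^ 3 + A (-6) * K 1 ^ 3
          - A (-2) * K 1 - A (-6) * K 1) ∧
    (virtualCrossingNumber knot447 = 3 ∧
      maxKDegree (arrowPolynomial knot447) = 3 ∧
      arrowPolynomial knot447 =
        A 2 * K 3 + 1 - A (-2) * K 1 * K 2 - A 2 * K 1 * K 2 + A (-2) * K 1) ∧
    (virtualCrossingNumber knot491 = 3 ∧
      minimalGenus knot491 = 1 ∧
      maxKDegree (arrowPolynomial knot491) = 3 ∧
      arrowPolynomial knot491 =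
        -A 10 * K 1 ^ 3 - A 6 * K 1 ^ 3 + A 2 * K 1 ^ 3 + 2 * A 6 * K 1 + A (-2) * K 1 ^ 3
          - 2 * A 2 * K 1 + A (-4)) :=
  ⟨⟨virtualCrossingNumber_knot422, maxKDegree_knot422, arrowPolynomial_knot422⟩,
    ⟨virtualCrossingNumber_knot447, maxKDegree_knot447, arrowPolynomial_knot447⟩,
    ⟨virtualCrossingNumber_knot491, minimalGenus_knot491, maxKDegree_knot491,
      arrowPolynomial_knot491⟩⟩
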